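/- Let $L\ge 1$, $N=L^2$, and consider the $\sqrt N\times\sqrt N$ grid $V=(\mathbb Z/L)^2$ with periodic boundary conditions, degree $d=4$, and rotation map $\mathcal R$ given by $\mathcal R((x,y),\rightarrow)=((x+1,y),\leftarrow)$, $\mathcal R((x,y),\leftarrow)=((x-1,y),\rightarrow)$, $\mathcal R((x,y),\uparrow)=((x,y+1),\downarrow)$, $\mathcal R((x,y),\downarrow)=((x,y-1),\uparrow)$. For $t\ge 1$ work in $\mathbb C^N\otimes\mathbb C^{d^t}$ with basis $|u,g_1,\dots,g_t\rangle$ ($u\in V$, $g_i$ directions). Let $S_t$ be the linear operator with $S_t|u,g_1,\dots,g_t\rangle=|v,h_1,\dots,h_t\rangle$, where $v$ is the end of the path that starts at $u$ and follows the labels $g_1,\dots,g_t$, and $h_1,\dots,h_t$ are the labels of the same path traversed from $v$ back to $u$. Put $|\psi^t_u\rangle=d^{-t/2}\sum_{g}|u,g\rangle$, $C_t=2\sum_u|\psi^t_u\rangle\langle\psi^t_u|-\mathbb I$, $W_t=S_tC_t$ and, for a marked vertex $m\in V$, $O_t=\mathbb I-2|\psi^t_m\rangle\langle\psi^t_m|$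 and $U_t=W_tO_t$. Let $|\Psi_S\rangle=N^{-1/2}\sum_u|\psi^t_u\rangle$, let $\alpha\in(0,\pi]$ be the smallest non-zero eigenphase of $U_t$ (the least $\theta\in(0,\pi]$ such that $e^{i\theta}$ is an eigenvalue; as $U_t$ has a real matrix, non-real eigenvalues come in pairs $e^{\pm i\theta}$), let $Q=\lfloor\pi/(2\alpha)\rfloor$, and let $p_s=|\langle\psi^t_m|U_t^{Q}|\Psi_S\rangle|^2$ be the success probability of the algorithm that applies $U_t$ to $|\Psi_S\rangle$ $Q$ times. Write $Q_O$ for the number of uses of $O_t$ and $Q_G$ for the number of uses of $\mathcal R$ (each applied to the vertex register and one edge label) in this algorithm. (a) $U_t^Q$ is implemented by a sequence of operations with $Q_O=Q$ and $Q_G=tQ$: each application of $U_t$ consists of $O_t$, then $C_t$, then $t$ uses of $\mathcal R$, on the vertex register and the edge labels $1,\dots,t$ in turn, then the reversal of the order of the edge labels. (b) If $t$ is odd and $t=O(\log N)$, then, for all sufficiently large $N$, $\alpha$ exists and $\alpha=\Theta\big(\sqrt{t/(N\log N)}\big)$, $p_s=\Omega(t/\log N)$. (c) If $t$ is odd and $t=\Theta(\log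 N)$, then the algorithm needs no amplitude amplification: $p_s=\Theta(1)$, $Q_O=\Theta(\sqrt N)$ and $Q_G=\Theta(\sqrt N\log N)$. Asymptotics are for $N\to\infty$; in (b) and (c) the implied constants and the threshold for $N$ depend only on the constants in the hypothesis on $t$, and not on $L$, $t$ or the marked vertex $m$. -/

import Mathlib

noncomputable section

namespace GridSearch

/-- The four directions (edge labels, `d = 4`) available at every vertex of the grid. -/
inductive Dir where
  | right
  | left
  | up
  | down
  deriving DecidableEq

instance : Fintype Dir where
  elems := {Dir.right, Dir.left, Dir.up, Dir.down}
  complete := by intro g; cases g <;> decide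

/-- Vertices of the `L × L` grid with periodic boundary conditions; the grid has `N = L ^ 2`
vertices. -/
abbrev Vertex (L : ℕ) : Type := ZMod L × ZMod L

/-- Labels of the computational basis of `ℂ^N ⊗ ℂ^(d^t)`: a vertex and `t` edge labels. -/
abbrev Label (L t : ℕ) : Type := Vertex L × (Fin t → Dir)

/-- The Hilbert space `ℂ^N ⊗ ℂ^(d^t)`. -/
abbrev Space (L t : ℕ) : Type := EuclideanSpace ℂ (Label L t)

/-- The rotation map of the grid: it crosses the edge labelled `g` at the vertex `u`, and returns
the other end of this edge together with its label there. -/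
def rot {L : ℕ} : Vertex L × Dir → Vertex L × Dir
  | ((x, y), Dir.right) => ((x + 1, y), Dir.left)
  | ((x, y), Dir.left) => ((x - 1, y), Dir.right)
  | ((x, y), Dir.up) => ((x, y + 1), Dir.down)
  | ((x, y), Dir.down) => ((x, y - 1), Dir.up)

/-- The vertex reached from `u` after the first `i` steps of the path with labels `g`. -/
def pathVertex {L t : ℕ} (u : Vertex L) (g : Fin t → Dir) : ℕ → Vertex L
  | 0 => u
  | i + 1 => if h : i < t then (rot (pathVertex u g i, g ⟨i, h⟩)).1 else pathVertex u g i

/-- The rotation map of the `t`-th power of the grid: the path which starts at `u` and has labels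
`g` is sent to its other end together with the labels of the same path traversed backwards. -/
def powerRot {L t : ℕ} (s : Label L t) : Label L t :=
  (pathVertex s.1 s.2 t, fun i => (rot (pathVertex s.1 s.2 (i.rev : ℕ), s.2 i.rev)).2)

/-- Basis vector `|u, g₁, …, g_t⟩`. -/
def ket {L t : ℕ} [NeZero L] (s : Label L t) : Space L t := EuclideanSpace.single s 1

/-- The linear operator which sends the basis vector `|s⟩` to `|f s⟩`. -/
def basisMap {L t : ℕ} [NeZero L] (f : Label L t → Label L t) : Module.End ℂ (Space L t) :=
  (EuclideanSpace.basisFun (Label L t) ℂ).toBasis.constr ℂ (fun s => ket (f s))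

/-- The operator `|v⟩⟨v|`. -/
def ketBra {L t : ℕ} [NeZero L] (v : Space L t) : Module.End ℂ (Space L t) :=
  ((InnerProductSpace.rankOne ℂ v v : Space L t →L[ℂ] Space L t) : Space L t →ₗ[ℂ] Space L t)

/-- `|ψ_u⟩ = d^(-t/2) ∑_g |u, g⟩`, the uniform superposition of all labels at the vertex `u`. -/
def psi {L : ℕ} [NeZero L] (t : ℕ) (u : Vertex L) : Space L t :=
  (((Real.sqrt (4 ^ t))⁻¹ : ℝ) : ℂ) • (∑ g : Fin t → Dir, ket (u, g))

/-- The shift operator `S_t` of the powered grid. -/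
def shift (L t : ℕ) [NeZero L] : Module.End ℂ (Space L t) := basisMap powerRot

/-- The coin operator `C_t = 2 ∑_u |ψ_u⟩⟨ψ_u| - 1`. -/
def coin (L t : ℕ) [NeZero L] : Module.End ℂ (Space L t) :=
  (2 : ℂ) • (∑ u : Vertex L, ketBra (psi t u)) - 1

/-- The multi-step walk operator `W_t = S_t C_t`. -/
def walk (L t : ℕ) [NeZero L] : Module.End ℂ (Space L t) := shift L t * coin L t

/-- The target state oracle `O_t = 1 - 2 |ψ_m⟩⟨ψ_m|`, with marked vertex `m`. -/
def oracle {L : ℕ} [NeZero L] (t : ℕ) (m : Vertex L) : Module.End ℂ (Space L t) :=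
  1 - (2 : ℂ) • ketBra (psi t m)

/-- The search operator `U_t = W_t O_t`. -/
def searchOp {L : ℕ} [NeZero L] (t : ℕ) (m : Vertex L) : Module.End ℂ (Space L t) :=
  walk L t * oracle t m

/-- The starting state `N^(-1/2) ∑_u |ψ_u⟩`. -/
def startState (L t : ℕ) [NeZero L] : Space L t :=
  (((Real.sqrt ((L : ℝ) ^ 2))⁻¹ : ℝ) : ℂ) • (∑ u : Vertex L, psi t u)

/-- The non-zero eigenphases of `U_t`. The matrix of `U_t` is real, so its eigenphases in `(-π, π)`
come in pairs `±θ`, and it suffices to record those in `(0, π]`. -/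
def eigenphases {L : ℕ} [NeZero L] (t : ℕ) (m : Vertex L) : Set ℝ :=
  {θ : ℝ | 0 < θ ∧ θ ≤ Real.pi ∧
    (searchOp t m).HasEigenvalue (Complex.exp (Complex.I * (θ : ℂ)))}

/-- `α`, the smallest non-zero eigenphase of `U_t`. -/
def alpha {L : ℕ} [NeZero L] (t : ℕ) (m : Vertex L) : ℝ := sInf (eigenphases t m)

/-- The number `Q = ⌊π / (2 α)⌋` of applications of `U_t`. -/
def iterations {L : ℕ} [NeZero L] (t : ℕ) (m : Vertex L) : ℕ :=
  ⌊Real.pi / (2 * alpha t m)⌋₊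

/-- The probability `|⟨ψ_m| U_t^Q |Ψ_S⟩|^2` of finding the target state `|ψ_m⟩` after `Q`
applications of the search operator to the starting state. -/
def successProb {L : ℕ} [NeZero L] (t : ℕ) (m : Vertex L) (Q : ℕ) : ℝ :=
  ‖inner ℂ (psi t m) ((searchOp t m ^ Q) (startState L t))‖ ^ 2

/-- The elementary operations of the algorithm. `target` is one query to the target state oracle;
`edge i` is one query to the graph structure oracle, with the vertex register and the `i`-th edge
label; `coin` and `reverse` (reversal of the order of the edge labels) use neither oracle. -/
inductive Gate (t : ℕ) where
  | target
  | edge (i : Fin t)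
  | coin
  | reverse

/-- One use of the rotation map of the grid on the vertex register and the `i`-th edge label. -/
def edgeStep {L t : ℕ} (i : Fin t) (s : Label L t) : Label L t :=
  ((rot (s.1, s.2 i)).1, Function.update s.2 i (rot (s.1, s.2 i)).2)

/-- The operator implemented by an elementary operation. -/
def Gate.toOp {L t : ℕ} [NeZero L] (m : Vertex L) : Gate t → Module.End ℂ (Space L t)
  | Gate.target => oracle t m
  | Gate.edge i => basisMap (edgeStep i)
  | Gate.coin => GridSearch.coin L t
  | Gate.reverse => basisMap (fun s => (s.1, fun i => s.2 i.rev))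

/-- Whether an operation is a query to the target state oracle. -/
def Gate.isTarget {t : ℕ} : Gate t → Bool
  | Gate.target => true
  | _ => false

/-- Whether an operation is a query to the graph structure oracle. -/
def Gate.isEdge {t : ℕ} : Gate t → Bool
  | Gate.edge _ => true
  | _ => false

/-- The operator implemented by a sequence of operations; the head is executed first. -/
def runGates {L t : ℕ} [NeZero L] (m : Vertex L) : List (Gate t) → Module.End ℂ (Space L t)
  | [] => 1
  | a :: l => runGates m l * a.toOp m

/-- One iteration: the target oracle, the coin, the rotation map with the first, second, …, `t`-th
edge label, and the reversal of the edge labels. -/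
def iterationGates (t : ℕ) : List (Gate t) :=
  Gate.target :: Gate.coin :: (List.ofFn (fun i : Fin t => Gate.edge i) ++ [Gate.reverse])

/-- The whole search algorithm: `Q = ⌊π / (2 α)⌋` iterations. -/
def searchGates {L : ℕ} [NeZero L] (t : ℕ) (m : Vertex L) : List (Gate t) :=
  (List.replicate (iterations t m) (iterationGates t)).flatten

/-- `Q_O`: the number of queries of the algorithm to the target state oracle. -/
def targetQueries {L : ℕ} [NeZero L] (t : ℕ) (m : Vertex L) : ℕ :=
  (searchGates t m).countP Gate.isTarget

/-- `Q_G`: the number of queries of the algorithm to the graph structure oracle. -/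
def graphQueries {L : ℕ} [NeZero L] (t : ℕ) (m : Vertex L) : ℕ :=
  (searchGates t m).countP Gate.isEdge

end GridSearch

end

/-!
The reflection `C_t O_t` fixes exactly the span of the states `|ψ_u⟩` with `u ≠ m`, so `U_t` is the
product of two reflections, and it acts on each plane spanned by `B f` and `S_t B f` as a rotation
by `θ`, where `f` is an eigenvector with eigenvalue `cos θ` of the `t`-step random walk `P ^ t` with
the row and the column of `m` removed (`SearchModel.IsDirichlet.sin_smul_U_pow`). Conversely every
eigenphase in `(0, π)` arises in this way (`SearchModel.cos_le_of_hasEigenvalue`). Hence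
`1 - cos α = x`, with `1 - x` the largest eigenvalue of the killed walk.

Let `ℓ_k` be the eigenvalues of `P ^ t`, `R = ∑_{k ≠ 0} 1 / (1 - ℓ_k)` and
`R₂ = ∑_{k ≠ 0} 1 / (1 - ℓ_k) ^ 2`. A trial vector gives `x ≤ 1 / R`
(`SearchModel.IsSpectral.exists_trial`), and in the basis of characters the eigenvalue equation
becomes the secular equation `1 / x = ∑_{k ≠ 0} 1 / (1 - ℓ_k - x)`, which gives `x ≥ 1 / (2 R)`.
The same equation shows that the stationary state differs from its projection onto the principal
eigenvector by a vector of norm at most `2 x √R₂` (`SearchModel.IsSpectral.dirichlet_bounds`). As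
`U_t` is unitary, this difference contributes at most `2 √R₂ / R` to the amplitude at `|ψ_m⟩` at any
time, while the principal eigenvector contributes at least a constant times `√(N / R)` after
`⌊π / (2 α)⌋` steps (`SearchModel.IsSpectral.norm_inner_U_pow_ge`, `search_bounds`).

On the grid `1 - ℓ_k` is comparable to `min (1, t |k|² / N)`, and two lattice sums give
`R = Θ(N log N / t)` and `R₂ = O(N² / t² + N)`. So `α² = Θ(1 / R)`, the amplitude is
`Ω(√(t / log N))`, and the contribution of the difference is of smaller order
(`search_asymptotics`).
-/

namespace GridSearch

/-! ### Paths in the grid and the query implementation -/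

theorem rot_rot {L : ℕ} (s : Vertex L × Dir) : rot (rot s) = s := by
  obtain ⟨⟨x, y⟩, g⟩ := s
  cases g <;> simp [rot]

theorem pathVertex_succ {L t : ℕ} (u : Vertex L) (g : Fin t → Dir) {i : ℕ} (h : i < t) :
    pathVertex u g (i + 1) = (rot (pathVertex u g i, g ⟨i, h⟩)).1 := by
  simp [pathVertex, h]

/-- The path with reversed labels visits the vertices of the original path in reverse order. -/
theorem pathVertex_powerRot {L t : ℕ} (s : Label L t) {i : ℕ} (hi : i ≤ t) :
    pathVertex (powerRot s).1 (powerRot s).2 i = pathVertex s.1 s.2 (t - i) := by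
  induction i with
  | zero => simp [pathVertex, powerRot]
  | succ i ih =>
    have hlt : i < t := hi
    rw [pathVertex_succ _ _ hlt, ih hlt.le]
    have h1 : t - i = (t - (i + 1)) + 1 := by omega
    have h2 : t - (i + 1) < t := by omega
    have hrev : (⟨i, hlt⟩ : Fin t).rev = ⟨t - (i + 1), h2⟩ := by ext; simp [Fin.rev]
    rw [h1, pathVertex_succ _ _ h2]
    simp only [powerRot, hrev]
    rw [Prod.mk.eta, rot_rot]

theorem powerRot_powerRot {L t : ℕ} (s : Label L t) : powerRot (powerRot s) = s := by
  refine Prod.ext ?_ (funext fun i => ?_)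
  · change pathVertex (powerRot s).1 (powerRot s).2 t = s.1
    rw [pathVertex_powerRot s le_rfl, Nat.sub_self, pathVertex]
  · change (rot (pathVertex (powerRot s).1 (powerRot s).2 (i.rev : ℕ), (powerRot s).2 i.rev)).2
      = s.2 i
    rw [pathVertex_powerRot s i.rev.isLt.le]
    have h1 : t - (i.rev : ℕ) = (i : ℕ) + 1 := by
      have := i.isLt
      simp only [Fin.val_rev]; omega
    rw [h1, pathVertex_succ _ _ i.isLt]
    simp only [powerRot, Fin.rev_rev]
    rw [Prod.mk.eta, rot_rot]

theorem basisMap_ket {L t : ℕ} [NeZero L] (f : Label L t → Label L t) (s : Label L t) :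
    basisMap f (ket s) = ket (f s) := by
  have h : (ket s : Space L t) = (EuclideanSpace.basisFun (Label L t) ℂ).toBasis s := by
    simp [ket]
  rw [basisMap, h, Module.Basis.constr_basis]

theorem end_ext_ket {L t : ℕ} [NeZero L] {T T' : Module.End ℂ (Space L t)}
    (h : ∀ s, T (ket s) = T' (ket s)) : T = T' := by
  refine (EuclideanSpace.basisFun (Label L t) ℂ).toBasis.ext fun s => ?_
  simpa [ket] using h s

theorem basisMap_mul {L t : ℕ} [NeZero L] (f g : Label L t → Label L t) :
    basisMap f * basisMap g = basisMap (f ∘ g) :=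
  end_ext_ket fun s => by simp [Module.End.mul_apply, basisMap_ket]

theorem basisMap_id {L t : ℕ} [NeZero L] : basisMap (id : Label L t → Label L t) = 1 :=
  end_ext_ket fun s => by simp [basisMap_ket]

theorem runGates_append {L t : ℕ} [NeZero L] (m : Vertex L) (l₁ l₂ : List (Gate t)) :
    runGates m (l₁ ++ l₂) = runGates m l₂ * runGates m l₁ := by
  induction l₁ with
  | nil => simp [runGates]
  | cons a l ih => simp [runGates, ih, mul_assoc]

/-- The configuration after the rotation map has been applied to the first `i` edge labels. -/
def partialWalk {L t : ℕ} (i : ℕ) (s : Label L t) : Label L t :=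
  (pathVertex s.1 s.2 i,
    fun j => if (j : ℕ) < i then (rot (pathVertex s.1 s.2 j, s.2 j)).2 else s.2 j)

theorem edgeStep_partialWalk {L t : ℕ} (i : Fin t) (s : Label L t) :
    edgeStep i (partialWalk i s) = partialWalk (i + 1) s := by
  refine Prod.ext ?_ (funext fun j => ?_)
  · simp [edgeStep, partialWalk, pathVertex_succ _ _ i.isLt]
  · rcases eq_or_ne j i with rfl | hj
    · simp [edgeStep, partialWalk]
    · have h : (j : ℕ) < i + 1 ↔ (j : ℕ) < i := by
        have : (j : ℕ) ≠ i := fun h => hj (Fin.ext h)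
        omega
      simp only [edgeStep, partialWalk, h, Function.update_of_ne hj]

theorem runGates_edges {L t : ℕ} [NeZero L] (m : Vertex L) {i : ℕ} (hi : i ≤ t) :
    runGates m ((List.ofFn fun i : Fin t => Gate.edge i).take i) = basisMap (partialWalk i) := by
  induction i with
  | zero =>
    have h : (partialWalk 0 : Label L t → Label L t) = id := by
      funext s
      simp [partialWalk, pathVertex]
    simp [runGates, h, basisMap_id]
  | succ i ih =>
    have hlt : i < t := hi
    rw [List.take_add_one, runGates_append, ih hlt.le]
    have h : (List.ofFn fun i : Fin t => Gate.edge i)[i]?.toList = [Gate.edge ⟨i, hlt⟩] := by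
      simp [hlt]
    rw [h]
    simp only [runGates, one_mul, Gate.toOp, basisMap_mul]
    congr 1
    funext s
    exact edgeStep_partialWalk ⟨i, hlt⟩ s

theorem runGates_iterationGates {L : ℕ} [NeZero L] (t : ℕ) (m : Vertex L) :
    runGates m (iterationGates t) = searchOp t m := by
  have h := runGates_edges m (le_refl t)
  rw [List.take_of_length_le (by simp)] at h
  have hrev : basisMap (fun s : Label L t => (s.1, fun i => s.2 i.rev)) * basisMap (partialWalk t)
      = shift L t := by
    rw [basisMap_mul, shift]
    congr 1
    funext s
    refine Prod.ext rfl (funext fun i => ?_)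
    simp [partialWalk, powerRot]
  simp only [iterationGates, runGates, runGates_append, h, Gate.toOp, one_mul]
  rw [hrev, searchOp, walk]

theorem runGates_searchGates {L : ℕ} [NeZero L] (t : ℕ) (m : Vertex L) :
    runGates m (searchGates t m) = searchOp t m ^ iterations t m := by
  rw [searchGates]
  induction iterations t m with
  | zero => simp [runGates]
  | succ n ih =>
    rw [List.replicate_succ, List.flatten_cons, runGates_append, ih, runGates_iterationGates,
      pow_succ]

theorem targetQueries_eq {L : ℕ} [NeZero L] (t : ℕ) (m : Vertex L) :
    targetQueries t m = iterations t m := by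
  have h : (iterationGates t).countP Gate.isTarget = 1 := by
    have h' : (List.ofFn fun i : Fin t => Gate.edge i).countP Gate.isTarget = 0 :=
      List.countP_eq_zero.2 (by simp [Gate.isTarget])
    rw [iterationGates, List.countP_cons, List.countP_cons, List.countP_append, h']
    simp [Gate.isTarget]
  simp [targetQueries, searchGates, List.countP_flatten, h]

theorem graphQueries_eq {L : ℕ} [NeZero L] (t : ℕ) (m : Vertex L) :
    graphQueries t m = t * iterations t m := by
  have h : (iterationGates t).countP Gate.isEdge = t := by
    have h' : (List.ofFn fun i : Fin t => Gate.edge i).countP Gate.isEdge = t := by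
      rw [List.countP_eq_length.2 (by simp [Gate.isEdge]), List.length_ofFn]
    rw [iterationGates, List.countP_cons, List.countP_cons, List.countP_append, h']
    simp [Gate.isEdge]
  simp [graphQueries, searchGates, List.countP_flatten, h, mul_comm]

/-! ### Lattice sums -/

theorem sum_inv_mul_le (M n : ℕ) (hn : 1 ≤ n) :
    ∑ b ∈ Finset.range M, (1 : ℝ) / (((n : ℝ) + b) * ((n : ℝ) + b + 1)) ≤ 1 / (n : ℝ) := by
  have hn0 : (0 : ℝ) < n := by exact_mod_cast hn
  have h : ∀ M : ℕ, ∑ b ∈ Finset.range M, (1 : ℝ) / (((n : ℝ) + b) * ((n : ℝ) + b + 1))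
      = 1 / n - 1 / (n + M) := by
    intro M
    induction M with
    | zero => simp
    | succ M ih =>
      rw [Finset.sum_range_succ, ih]
      push_cast
      field_simp
      ring
  rw [h]
  have : (0 : ℝ) < 1 / ((n : ℝ) + M) := by positivity
  linarith

/-- `∑_{b = 1}^M 1 / (a² + b²) ≤ 2 / a`, by comparison with `2 / ((a + b - 1) (a + b))`. -/
theorem sum_inv_add_sq_le (M a : ℕ) (ha : 1 ≤ a) :
    ∑ b ∈ Finset.range M, (1 : ℝ) / ((a : ℝ) ^ 2 + ((b : ℝ) + 1) ^ 2) ≤ 2 / (a : ℝ) := by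
  have ha0 : (1 : ℝ) ≤ a := by exact_mod_cast ha
  calc _ ≤ ∑ b ∈ Finset.range M, 2 * ((1 : ℝ) / (((a : ℝ) + b) * ((a : ℝ) + b + 1))) := by
        refine Finset.sum_le_sum fun b _ => ?_
        have hb : (0 : ℝ) ≤ b := b.cast_nonneg
        rw [mul_one_div, div_le_div_iff₀ (by positivity) (by positivity)]
        nlinarith [sq_nonneg ((a : ℝ) - (b + 1))]
    _ ≤ 2 / (a : ℝ) := by
        rw [← Finset.mul_sum]
        have := sum_inv_mul_le M a ha
        calc _ ≤ 2 * (1 / (a : ℝ)) := by gcongr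
          _ = _ := by ring

theorem sum_inv_sq_le (M : ℕ) : ∑ b ∈ Finset.range M, (1 : ℝ) / ((b : ℝ) + 1) ^ 2 ≤ 2 := by
  refine le_trans (Finset.sum_le_sum fun b _ => ?_)
    ((Finset.mul_sum _ _ _).symm.le.trans (mul_le_mul_of_nonneg_left (sum_inv_mul_le M 1 le_rfl)
      (zero_le_two (α := ℝ))) |>.trans (by norm_num))
  have hb : (0 : ℝ) ≤ b := b.cast_nonneg
  rw [mul_one_div, div_le_div_iff₀ (by positivity) (by push_cast; positivity)]
  push_cast
  nlinarith

theorem sum_inv_add_one_le (M : ℕ) :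
    ∑ b ∈ Finset.range M, (1 : ℝ) / ((b : ℝ) + 1) ≤ 1 + Real.log M := by
  have := harmonic_le_one_add_log M
  simpa [harmonic] using this

theorem le_sum_inv_add_one (M : ℕ) :
    Real.log (M + 1) ≤ ∑ b ∈ Finset.range M, (1 : ℝ) / ((b : ℝ) + 1) := by
  have := log_add_one_le_harmonic M
  simpa [harmonic] using this

/-- Distance to `0` along the cycle of length `L`. -/
def cycleNorm {L : ℕ} (k : ZMod L) : ℕ := min k.val (L - k.val)

theorem cycleNorm_pos {L : ℕ} [NeZero L] {k : ZMod L} (hk : k ≠ 0) : 1 ≤ cycleNorm k := by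
  have h1 := ZMod.val_lt k
  have h2 : k.val ≠ 0 := by simpa using hk
  unfold cycleNorm; omega

theorem sum_val {L : ℕ} [NeZero L] (F : ℕ → ℝ) :
    ∑ k : ZMod L, F k.val = ∑ n ∈ Finset.range L, F n := by
  obtain ⟨n, rfl⟩ := Nat.exists_eq_succ_of_ne_zero (NeZero.ne L)
  exact Fin.sum_univ_eq_sum_range F (n + 1)

/-- At most two points of the cycle have a given distance to `0`. -/
theorem sum_cycleNorm_le {L : ℕ} [NeZero L] (F : ℕ → ℝ) (hF : ∀ n, 0 ≤ F n) :
    ∑ k : ZMod L, F (cycleNorm k) ≤ F 0 + 2 * ∑ d ∈ Finset.range L, F (d + 1) := by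
  set G : ℕ → ℝ := fun n => if n = 0 then 0 else F n with hG
  have hG0 : ∀ n, 0 ≤ G n := fun n => by
    by_cases h : n = 0 <;> simp [hG, h, hF]
  have h1 : ∑ k : ZMod L, G k.val ≤ ∑ d ∈ Finset.range L, F (d + 1) := by
    obtain ⟨n, hn⟩ := Nat.exists_eq_succ_of_ne_zero (NeZero.ne L)
    rw [sum_val, hn, Finset.sum_range_succ', Finset.sum_range_succ]
    simpa [hG] using hF (n + 1)
  have h2 : ∑ k : ZMod L, G (-k).val = ∑ k : ZMod L, G k.val :=
    Fintype.sum_equiv (Equiv.neg _) _ _ fun k => rfl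
  have h3 : ∀ k : ZMod L, F (cycleNorm k)
      ≤ (if k = 0 then F 0 else 0) + (G k.val + G (-k).val) := by
    intro k
    by_cases hk : k = 0
    · subst hk
      simp [hG, cycleNorm]
    · have hpos := cycleNorm_pos hk
      have hneg : (-k).val = L - k.val := by
        have : NeZero k := ⟨hk⟩
        exact ZMod.val_neg_of_ne_zero k
      have hFG : F (cycleNorm k) = G (cycleNorm k) := by
        have : cycleNorm k ≠ 0 := by omega
        simp [hG, this]
      rw [hFG, if_neg hk, zero_add, hneg, cycleNorm]
      rcases min_choice k.val (L - k.val) with h | h <;> rw [h]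
      · linarith [hG0 (L - k.val)]
      · linarith [hG0 k.val]
  calc _ ≤ ∑ k : ZMod L, ((if k = 0 then F 0 else 0) + (G k.val + G (-k).val)) :=
        Finset.sum_le_sum fun k _ => h3 k
    _ = F 0 + (∑ k : ZMod L, G k.val + ∑ k : ZMod L, G k.val) := by
        rw [Finset.sum_add_distrib, Finset.sum_add_distrib, h2]
        simp
    _ ≤ _ := by linarith

/-- The sum over the grid splits into the two axes and the four quadrants. The hypothesis on `F 0 0`
holds for `F m n = 1 / (m² + n²)`, as `1 / 0 = 0`. -/
theorem sum_vertex_cycleNorm_le {L : ℕ} [NeZero L] (F : ℕ → ℕ → ℝ) (hF : ∀ m n, 0 ≤ F m n)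
    (h0 : F 0 0 = 0) :
    ∑ k ∈ Finset.univ.filter (fun k : Vertex L => k ≠ 0), F (cycleNorm k.1) (cycleNorm k.2)
      ≤ 2 * ∑ d ∈ Finset.range L, F 0 (d + 1) + 2 * ∑ d ∈ Finset.range L, F (d + 1) 0
        + 4 * ∑ d ∈ Finset.range L, ∑ d' ∈ Finset.range L, F (d + 1) (d' + 1) := by
  calc _ ≤ ∑ k : Vertex L, F (cycleNorm k.1) (cycleNorm k.2) :=
        Finset.sum_le_sum_of_subset_of_nonneg (Finset.filter_subset _ _) fun _ _ _ => hF _ _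
    _ = ∑ k₁ : ZMod L, ∑ k₂ : ZMod L, F (cycleNorm k₁) (cycleNorm k₂) :=
        Fintype.sum_prod_type' fun (k₁ k₂ : ZMod L) => F (cycleNorm k₁) (cycleNorm k₂)
    _ ≤ ∑ k₁ : ZMod L, (F (cycleNorm k₁) 0
          + 2 * ∑ d ∈ Finset.range L, F (cycleNorm k₁) (d + 1)) :=
        Finset.sum_le_sum fun k₁ _ => sum_cycleNorm_le _ fun n => hF _ _
    _ ≤ (F 0 0 + 2 * ∑ d ∈ Finset.range L, F 0 (d + 1))
          + 2 * ∑ d' ∈ Finset.range L, (F (d' + 1) 0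
            + 2 * ∑ d ∈ Finset.range L, F (d' + 1) (d + 1)) :=
        sum_cycleNorm_le (fun n => F n 0 + 2 * ∑ d ∈ Finset.range L, F n (d + 1)) fun n =>
          add_nonneg (hF _ _) (mul_nonneg zero_le_two (Finset.sum_nonneg fun _ _ => hF _ _))
    _ = _ := by
        rw [h0, Finset.sum_add_distrib, ← Finset.mul_sum]
        ring

theorem sum_inv_cycleNorm_sq_le {L : ℕ} [NeZero L] :
    ∑ k ∈ Finset.univ.filter (fun k : Vertex L => k ≠ 0),
      (1 : ℝ) / ((cycleNorm k.1 : ℝ) ^ 2 + (cycleNorm k.2 : ℝ) ^ 2) ≤ 16 + 8 * Real.log L := by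
  have h := sum_vertex_cycleNorm_le (L := L) (fun m n => (1 : ℝ) / ((m : ℝ) ^ 2 + (n : ℝ) ^ 2))
    (fun m n => by positivity) (by simp)
  refine h.trans ?_
  have h1 := sum_inv_sq_le L
  have h2 : ∑ d ∈ Finset.range L, ∑ d' ∈ Finset.range L,
      (1 : ℝ) / (((d : ℝ) + 1) ^ 2 + ((d' : ℝ) + 1) ^ 2) ≤ 2 * (1 + Real.log L) := by
    calc _ ≤ ∑ d ∈ Finset.range L, 2 * ((1 : ℝ) / ((d : ℝ) + 1)) := by
          refine Finset.sum_le_sum fun d _ => ?_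
          have := sum_inv_add_sq_le L (d + 1) (by omega)
          push_cast at this
          rwa [mul_one_div]
      _ ≤ _ := by
          rw [← Finset.mul_sum]
          gcongr
          exact sum_inv_add_one_le L
  push_cast
  simp only [ne_eq, OfNat.ofNat_ne_zero, not_false_eq_true, zero_pow, zero_add, add_zero]
  linarith

theorem sum_inv_cycleNorm_sq_sq_le {L : ℕ} [NeZero L] :
    ∑ k ∈ Finset.univ.filter (fun k : Vertex L => k ≠ 0),
      ((1 : ℝ) / ((cycleNorm k.1 : ℝ) ^ 2 + (cycleNorm k.2 : ℝ) ^ 2)) ^ 2 ≤ 24 := by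
  have h := sum_vertex_cycleNorm_le (L := L)
    (fun m n => ((1 : ℝ) / ((m : ℝ) ^ 2 + (n : ℝ) ^ 2)) ^ 2) (fun m n => by positivity) (by simp)
  refine h.trans ?_
  have h0 : ∀ d : ℕ, (0 : ℝ) < 1 / ((d : ℝ) + 1) ^ 2 ∧ (1 : ℝ) / ((d : ℝ) + 1) ^ 2 ≤ 1 := by
    intro d
    have hd : (0 : ℝ) ≤ d := d.cast_nonneg
    refine ⟨by positivity, ?_⟩
    rw [div_le_one (by positivity)]
    nlinarith
  have h1 : ∑ d ∈ Finset.range L, ((1 : ℝ) / ((d : ℝ) + 1) ^ 2) ^ 2 ≤ 2 := by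
    refine le_trans (Finset.sum_le_sum fun d _ => ?_) (sum_inv_sq_le L)
    nlinarith [h0 d]
  have h2 : ∑ d ∈ Finset.range L, ∑ d' ∈ Finset.range L,
      ((1 : ℝ) / (((d : ℝ) + 1) ^ 2 + ((d' : ℝ) + 1) ^ 2)) ^ 2 ≤ 4 := by
    calc _ ≤ ∑ d ∈ Finset.range L, 2 * ((1 : ℝ) / ((d : ℝ) + 1) ^ 2) := by
          refine Finset.sum_le_sum fun d _ => ?_
          have := sum_inv_add_sq_le L (d + 1) (by omega)
          push_cast at this
          have hd : (0 : ℝ) ≤ d := d.cast_nonneg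
          calc _ ≤ ∑ d' ∈ Finset.range L,
              (1 / ((d : ℝ) + 1) ^ 2) * ((1 : ℝ) / (((d : ℝ) + 1) ^ 2 + ((d' : ℝ) + 1) ^ 2)) := by
                refine Finset.sum_le_sum fun d' _ => ?_
                rw [pow_two]
                gcongr
                nlinarith [sq_nonneg ((d' : ℝ) + 1)]
            _ ≤ (1 / ((d : ℝ) + 1) ^ 2) * (2 / ((d : ℝ) + 1)) := by
                rw [← Finset.mul_sum]
                gcongr
            _ ≤ (1 / ((d : ℝ) + 1) ^ 2) * 2 := by
                gcongr
                exact div_le_self zero_le_two (by linarith)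
            _ = _ := by ring
      _ ≤ _ := by
          rw [← Finset.mul_sum]
          linarith [sum_inv_sq_le L]
  push_cast
  simp only [ne_eq, OfNat.ofNat_ne_zero, not_false_eq_true, zero_pow, zero_add, add_zero]
  linarith

/-- The lattice sum restricted to the wedge `1 ≤ b ≤ a < L` grows logarithmically. -/
theorem log_le_sum_inv_val_sq {L : ℕ} [NeZero L] :
    Real.log L / 2 ≤ ∑ k ∈ Finset.univ.filter (fun k : Vertex L => k ≠ 0),
      (1 : ℝ) / ((k.1.val : ℝ) ^ 2 + (k.2.val : ℝ) ^ 2) := by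
  -- the term at `k = 0` is `1 / 0 = 0`
  have hfilter : ∑ k ∈ Finset.univ.filter (fun k : Vertex L => k ≠ 0),
      (1 : ℝ) / ((k.1.val : ℝ) ^ 2 + (k.2.val : ℝ) ^ 2)
      = ∑ k : Vertex L, (1 : ℝ) / ((k.1.val : ℝ) ^ 2 + (k.2.val : ℝ) ^ 2) := by
    refine Finset.sum_subset (Finset.filter_subset _ _) fun k _ hk => ?_
    have : k = 0 := by simpa using hk
    simp [this]
  have hprod : ∑ k : Vertex L, (1 : ℝ) / ((k.1.val : ℝ) ^ 2 + (k.2.val : ℝ) ^ 2)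
      = ∑ a ∈ Finset.range L, ∑ b ∈ Finset.range L, (1 : ℝ) / ((a : ℝ) ^ 2 + (b : ℝ) ^ 2) := by
    rw [← sum_val fun a => ∑ b ∈ Finset.range L, (1 : ℝ) / ((a : ℝ) ^ 2 + (b : ℝ) ^ 2)]
    simp_rw [← sum_val fun b => (1 : ℝ) / ((_ : ℝ) ^ 2 + (b : ℝ) ^ 2)]
    exact Fintype.sum_prod_type' fun (k₁ k₂ : ZMod L) =>
      (1 : ℝ) / ((k₁.val : ℝ) ^ 2 + (k₂.val : ℝ) ^ 2)
  rw [hfilter, hprod]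
  obtain ⟨n, rfl⟩ := Nat.exists_eq_succ_of_ne_zero (NeZero.ne L)
  have hrow : ∀ a ∈ Finset.range n, 1 / (2 * ((a : ℝ) + 1))
      ≤ ∑ b ∈ Finset.range (n + 1), (1 : ℝ) / (((a + 1 : ℕ) : ℝ) ^ 2 + (b : ℝ) ^ 2) := by
    intro a ha
    have ha' := Finset.mem_range.1 ha
    have hsub : Finset.range (a + 1) ⊆ Finset.range (n + 1) :=
      Finset.range_subset_range.2 (by omega)
    refine le_trans ?_ (Finset.sum_le_sum_of_subset_of_nonneg hsub fun _ _ _ => by positivity)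
    calc _ = ∑ b ∈ Finset.range (a + 1), (1 : ℝ) / (2 * ((a : ℝ) + 1) ^ 2) := by
          rw [Finset.sum_const, Finset.card_range, nsmul_eq_mul]
          push_cast
          field_simp
      _ ≤ _ := by
          refine Finset.sum_le_sum fun b hb => ?_
          have hb' : (b : ℝ) ≤ a := by exact_mod_cast Nat.lt_succ_iff.1 (Finset.mem_range.1 hb)
          push_cast
          gcongr
          nlinarith
  calc _ ≤ (∑ a ∈ Finset.range n, (1 : ℝ) / ((a : ℝ) + 1)) / 2 := by
        have := le_sum_inv_add_one n
        push_cast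
        linarith
    _ = ∑ a ∈ Finset.range n, 1 / (2 * ((a : ℝ) + 1)) := by
        rw [Finset.sum_div]
        refine Finset.sum_congr rfl fun a _ => ?_
        field_simp
    _ ≤ _ := by
        rw [Finset.sum_range_succ']
        exact (Finset.sum_le_sum hrow).trans
          (le_add_of_nonneg_right (Finset.sum_nonneg fun _ _ => by positivity))

/-! ### Search by a walk with two reflections -/

/-- An abstract quantum walk search. `B` embeds the state space `E` of a random walk isometrically
into the space `H` of the quantum walk, `C` is the adjoint of `B`, the shift `S` is a self-adjoint
involution, and the unit vector `δ` is the marked state. -/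
structure SearchModel (E H : Type*) [NormedAddCommGroup E] [InnerProductSpace ℂ E]
    [NormedAddCommGroup H] [InnerProductSpace ℂ H] where
  B : E →ₗ[ℂ] H
  C : H →ₗ[ℂ] E
  S : H →ₗ[ℂ] H
  δ : E
  inner_B : ∀ f w, inner ℂ (B f) w = inner ℂ f (C w)
  C_B : ∀ f, C (B f) = f
  inner_S : ∀ v w, inner ℂ (S v) w = inner ℂ v (S w)
  S_S : ∀ v, S (S v) = v
  norm_δ : ‖δ‖ = 1

namespace SearchModel

variable {E H : Type*} [NormedAddCommGroup E] [InnerProductSpace ℂ E]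
  [NormedAddCommGroup H] [InnerProductSpace ℂ H] (M : SearchModel E H)

/-- The transition operator `B† S B` of the random walk. -/
def A : E →ₗ[ℂ] E := M.C ∘ₗ M.S ∘ₗ M.B

/-- The projection onto the orthogonal complement of the marked state. -/
noncomputable def proj : E →ₗ[ℂ] E := LinearMap.id - (innerₛₗ ℂ M.δ).smulRight M.δ

/-- The search operator: the reflection about the image under `B` of the unmarked states, followed
by the shift. -/
noncomputable def U : H →ₗ[ℂ] H := M.S ∘ₗ ((2 : ℂ) • (M.B ∘ₗ M.proj ∘ₗ M.C) - LinearMap.id)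

theorem A_apply (f : E) : M.A f = M.C (M.S (M.B f)) := rfl

theorem proj_apply (f : E) : M.proj f = f - inner ℂ M.δ f • M.δ := rfl

theorem U_apply (w : H) : M.U w = M.S ((2 : ℂ) • M.B (M.proj (M.C w)) - w) := rfl

theorem inner_δ_δ : inner ℂ M.δ M.δ = 1 := by
  rw [inner_self_eq_norm_sq_to_K, M.norm_δ]; simp

theorem inner_C (w : H) (f : E) : inner ℂ (M.C w) f = inner ℂ w (M.B f) := by
  rw [← inner_conj_symm, ← M.inner_B, inner_conj_symm]

theorem inner_A (f g : E) : inner ℂ (M.A f) g = inner ℂ f (M.A g) := by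
  rw [A_apply, A_apply, inner_C, M.inner_S, M.inner_B]

theorem inner_δ_proj (f : E) : inner ℂ M.δ (M.proj f) = 0 := by
  rw [proj_apply, inner_sub_right, inner_smul_right, inner_δ_δ, mul_one, sub_self]

theorem proj_of_inner_eq_zero {f : E} (hf : inner ℂ M.δ f = 0) : M.proj f = f := by
  rw [proj_apply, hf, zero_smul, sub_zero]

theorem inner_proj_right {g : E} (hg : inner ℂ M.δ g = 0) (f : E) :
    inner ℂ g (M.proj f) = inner ℂ g f := by
  have hg' : inner ℂ g M.δ = 0 := by rw [← inner_conj_symm, hg, map_zero]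
  rw [proj_apply, inner_sub_right, inner_smul_right, hg', mul_zero, sub_zero]

theorem norm_B (f : E) : ‖M.B f‖ = ‖f‖ := by
  have h : inner ℂ (M.B f) (M.B f) = inner ℂ f f := by rw [M.inner_B, M.C_B]
  rw [norm_eq_sqrt_re_inner (𝕜 := ℂ), h, ← norm_eq_sqrt_re_inner]

theorem norm_S (w : H) : ‖M.S w‖ = ‖w‖ := by
  have h : inner ℂ (M.S w) (M.S w) = inner ℂ w w := by rw [M.inner_S, M.S_S]
  rw [norm_eq_sqrt_re_inner (𝕜 := ℂ), h, ← norm_eq_sqrt_re_inner]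

theorem norm_U (w : H) : ‖M.U w‖ = ‖w‖ := by
  rw [U_apply, norm_S]
  set g := M.proj (M.C w) with hg
  have h1 : inner ℂ (M.B g) w = inner ℂ g g := by
    rw [M.inner_B, ← M.inner_proj_right (M.inner_δ_proj _)]
  have h2 : inner ℂ w (M.B g) = inner ℂ g g := by
    rw [← inner_conj_symm, h1, inner_conj_symm]
  have h3 : inner ℂ (M.B g) (M.B g) = inner ℂ g g := by rw [M.inner_B, M.C_B]
  have h : inner ℂ ((2 : ℂ) • M.B g - w) ((2 : ℂ) • M.B g - w) = inner ℂ w w := by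
    simp only [inner_sub_left, inner_sub_right, inner_smul_left, inner_smul_right, h1, h2, h3,
      map_ofNat]
    ring
  rw [norm_eq_sqrt_re_inner (𝕜 := ℂ), h, ← norm_eq_sqrt_re_inner]

theorem norm_U_pow (n : ℕ) (w : H) : ‖(M.U ^ n) w‖ = ‖w‖ := by
  induction n with
  | zero => simp
  | succ n ih => rw [pow_succ', Module.End.mul_apply, norm_U, ih]

/-- `f` is an eigenvector, with eigenvalue `μ`, of the transition operator with the row and the
column of the marked state removed. -/
structure IsDirichlet (μ : ℝ) (f : E) : Prop where
  inner_eq_zero : inner ℂ M.δ f = 0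
  A_eq : M.A f = (μ : ℂ) • f + inner ℂ M.δ (M.A f) • M.δ

variable {M}

theorem IsDirichlet.proj_A {μ : ℝ} {f : E} (hf : M.IsDirichlet μ f) :
    M.proj (M.A f) = (μ : ℂ) • f := by
  rw [proj_apply]
  nth_rewrite 1 [hf.A_eq]
  simp

theorem IsDirichlet.U_B {μ : ℝ} {f : E} (hf : M.IsDirichlet μ f) : M.U (M.B f) = M.S (M.B f) := by
  rw [U_apply, M.C_B, M.proj_of_inner_eq_zero hf.inner_eq_zero, two_smul, add_sub_cancel_right]

theorem IsDirichlet.U_S_B {μ : ℝ} {f : E} (hf : M.IsDirichlet μ f) :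
    M.U (M.S (M.B f)) = (2 * μ : ℂ) • M.S (M.B f) - M.B f := by
  rw [U_apply, ← A_apply, hf.proj_A, map_sub, M.S_S, map_smul, map_smul, map_smul, smul_smul]

/-- The search operator rotates the plane spanned by `B f` and `S B f`; its powers on `B f` are
given by the Chebyshev polynomials of the second kind. -/
theorem IsDirichlet.sin_smul_U_pow {θ : ℝ} {f : E} (hf : M.IsDirichlet (Real.cos θ) f) (n : ℕ) :
    (Real.sin θ : ℂ) • (M.U ^ n) (M.B f)
      = (Real.sin (n * θ) : ℂ) • M.S (M.B f) - (Real.sin (n * θ - θ) : ℂ) • M.B f := by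
  induction n with
  | zero => simp
  | succ n ih =>
    rw [pow_succ', Module.End.mul_apply, ← map_smul, ih, map_sub, map_smul, map_smul, hf.U_S_B,
      hf.U_B]
    have h1 : ((n + 1 : ℕ) : ℝ) * θ - θ = n * θ := by push_cast; ring
    have h2 : Real.sin ((n + 1 : ℕ) * θ)
        = 2 * Real.cos θ * Real.sin (n * θ) - Real.sin (n * θ - θ) := by
      push_cast
      rw [add_mul, one_mul, Real.sin_add, Real.sin_sub]; ring
    rw [h1, h2]
    push_cast
    module

theorem IsDirichlet.sin_mul_inner_U_pow {θ : ℝ} {f : E} (hf : M.IsDirichlet (Real.cos θ) f)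
    (n : ℕ) : (Real.sin θ : ℂ) * inner ℂ (M.B M.δ) ((M.U ^ n) (M.B f))
      = Real.sin (n * θ) * inner ℂ M.δ (M.A f) := by
  rw [← inner_smul_right, hf.sin_smul_U_pow, inner_sub_right, inner_smul_right, inner_smul_right,
    M.inner_B, M.inner_B, M.C_B, hf.inner_eq_zero, ← A_apply]
  simp

theorem IsDirichlet.inner_A_self {μ : ℝ} {f : E} (hf : M.IsDirichlet μ f) (h1 : ‖f‖ = 1) :
    inner ℂ f (M.A f) = μ := by
  rw [← M.inner_proj_right hf.inner_eq_zero, hf.proj_A, inner_smul_right,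
    inner_self_eq_norm_sq_to_K, h1]
  simp

theorem exp_I_eq (θ : ℝ) : Complex.exp (Complex.I * (θ : ℂ))
    = (Real.cos θ : ℂ) + (Real.sin θ : ℂ) * Complex.I := by
  rw [mul_comm, Complex.exp_mul_I]; simp

theorem cos_add_sin_I_mul_cos_sub_sin_I (θ : ℝ) :
    ((Real.cos θ : ℂ) + (Real.sin θ : ℂ) * Complex.I)
      * ((Real.cos θ : ℂ) - (Real.sin θ : ℂ) * Complex.I) = 1 := by
  have h : (Real.cos θ : ℂ) ^ 2 + (Real.sin θ : ℂ) ^ 2 = 1 := by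
    exact_mod_cast Real.cos_sq_add_sin_sq θ
  linear_combination h - (Real.sin θ : ℂ) ^ 2 * Complex.I_sq

theorem IsDirichlet.hasEigenvalue {θ : ℝ} {f : E} (hf : M.IsDirichlet (Real.cos θ) f)
    (h1 : ‖f‖ = 1) (hθ : Real.sin θ ≠ 0) :
    Module.End.HasEigenvalue M.U (Complex.exp (Complex.I * (θ : ℂ))) := by
  set z : ℂ := (Real.cos θ : ℂ) + (Real.sin θ : ℂ) * Complex.I with hz
  set z' : ℂ := (Real.cos θ : ℂ) - (Real.sin θ : ℂ) * Complex.I with hz'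
  have hzz : z * z' = 1 := cos_add_sin_I_mul_cos_sub_sin_I θ
  rw [exp_I_eq, ← hz]
  -- in the basis `S B f`, `B f` of its plane, `U` is the companion matrix of `z² - 2 z cos θ + 1`
  refine Module.End.hasEigenvalue_of_hasEigenvector
    (x := M.S (M.B f) - z' • M.B f) ⟨Module.End.mem_eigenspace_iff.2 ?_, fun h0 => hθ ?_⟩
  · rw [map_sub, map_smul, hf.U_S_B, hf.U_B, smul_sub, smul_smul, hzz, one_smul]
    have : (2 * (Real.cos θ : ℂ)) = z + z' := by rw [hz, hz']; ring
    rw [this]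
    module
  · have h2 : M.A f = z' • f := by
      have := congrArg M.C (sub_eq_zero.1 h0)
      rwa [map_smul, M.C_B, ← A_apply] at this
    have h3 := hf.inner_A_self h1
    rw [h2, inner_smul_right, inner_self_eq_norm_sq_to_K, h1] at h3
    have := congrArg Complex.im h3
    simpa [hz', -Complex.ofReal_sin, -Complex.ofReal_cos] using this

/-- Every eigenphase `θ` in `(0, π)` of the search operator is accounted for by the random walk:
`cos θ` is at most the largest Rayleigh quotient over the unmarked states. -/
theorem cos_le_of_hasEigenvalue {μ θ : ℝ} (hsin : 0 < Real.sin θ)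
    (hμ : ∀ g, inner ℂ M.δ g = 0 → (inner ℂ g (M.A g)).re ≤ μ * ‖g‖ ^ 2)
    (h : Module.End.HasEigenvalue M.U (Complex.exp (Complex.I * (θ : ℂ)))) : Real.cos θ ≤ μ := by
  obtain ⟨w, hw, hw0⟩ := h.exists_hasEigenvector
  rw [Module.End.mem_eigenspace_iff, exp_I_eq] at hw
  set z : ℂ := (Real.cos θ : ℂ) + (Real.sin θ : ℂ) * Complex.I with hz
  set z' : ℂ := (Real.cos θ : ℂ) - (Real.sin θ : ℂ) * Complex.I with hz'
  have hzz : z * z' = 1 := cos_add_sin_I_mul_cos_sub_sin_I θ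
  rw [U_apply] at hw
  set g := M.proj (M.C w) with hg
  have hgδ : inner ℂ M.δ g = 0 := M.inner_δ_proj _
  have e1 : (2 : ℂ) • M.B g - w = z • M.S w := by
    have := congrArg M.S hw
    rwa [M.S_S, map_smul] at this
  have e2 : (2 : ℂ) • M.S (M.B g) - M.S w = z • w := by
    rw [← hw, map_sub, map_smul]
  have hgw : inner ℂ (M.B g) w = (‖g‖ : ℂ) ^ 2 := by
    rw [M.inner_B, ← M.inner_proj_right hgδ, ← hg, inner_self_eq_norm_sq_to_K]; rfl
  have f1 : (‖g‖ : ℂ) ^ 2 = z * inner ℂ (M.B g) (M.S w) := by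
    have h := congrArg (inner ℂ (M.B g)) e1
    have h3 : inner ℂ (M.B g) (M.B g) = (‖g‖ : ℂ) ^ 2 := by
      rw [M.inner_B, M.C_B, inner_self_eq_norm_sq_to_K]; rfl
    rw [inner_sub_right, inner_smul_right, inner_smul_right, h3, hgw] at h
    linear_combination h
  have f2 : 2 * inner ℂ g (M.A g) - inner ℂ (M.B g) (M.S w) = z * (‖g‖ : ℂ) ^ 2 := by
    have h := congrArg (inner ℂ (M.B g)) e2
    rwa [inner_sub_right, inner_smul_right, inner_smul_right, hgw, M.inner_B g (M.S (M.B g)),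
      ← A_apply] at h
  have f3 : inner ℂ g (M.A g) = (Real.cos θ : ℂ) * (‖g‖ : ℂ) ^ 2 := by
    have : z + z' = 2 * (Real.cos θ : ℂ) := by rw [hz, hz']; ring
    linear_combination (1 / 2 : ℂ) * f2 - (1 / 2 : ℂ) * z' * f1
      - (1 / 2 : ℂ) * inner ℂ (M.B g) (M.S w) * hzz + (1 / 2 : ℂ) * (‖g‖ : ℂ) ^ 2 * this
  -- if `g = 0` then `U w = -S w`, and the eigenvalues of the involution `S` are `1` and `-1`
  have hg0 : g ≠ 0 := by
    intro h0
    rw [h0, map_zero] at e1 e2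
    rw [smul_zero, zero_sub] at e1
    rw [map_zero, smul_zero, zero_sub] at e2
    have h5 : (z ^ 2 - 1) • w = 0 := by
      rw [sub_smul, one_smul, pow_two, mul_smul, ← e2, smul_neg, ← e1]
      simp
    have h6 : z ^ 2 - 1 = 0 := (smul_eq_zero.1 h5).resolve_right hw0
    have h7 : (z - 1) * (z + 1) = 0 := by linear_combination h6
    rcases mul_eq_zero.1 h7 with h | h <;>
    · have := congrArg Complex.im h
      simp [hz, -Complex.ofReal_sin, -Complex.ofReal_cos] at this
      exact hsin.ne' this
  have h8 := hμ g hgδ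
  rw [f3] at h8
  have h9 : ((Real.cos θ : ℂ) * (‖g‖ : ℂ) ^ 2).re = Real.cos θ * ‖g‖ ^ 2 := by
    rw [← Complex.ofReal_pow, ← Complex.ofReal_mul, Complex.ofReal_re]
  rw [h9] at h8
  exact le_of_mul_le_mul_right h8 (by positivity)

theorem re_inner_eq_sum {ι : Type*} [Fintype ι] {E : Type*} [NormedAddCommGroup E]
    [InnerProductSpace ℂ E] (b : OrthonormalBasis ι ℂ E) (T : E →ₗ[ℂ] E) (ℓ : ι → ℝ) (g : E)
    (h : ∀ i, inner ℂ (b i) (T g) = ℓ i * inner ℂ (b i) g) :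
    (inner ℂ g (T g)).re = ∑ i, ℓ i * ‖inner ℂ (b i) g‖ ^ 2 := by
  rw [← b.sum_inner_mul_inner g (T g), Complex.re_sum]
  refine Finset.sum_congr rfl fun i _ => ?_
  have h1 : inner ℂ g (b i) * inner ℂ (b i) (T g)
      = ((ℓ i * ‖inner ℂ (b i) g‖ ^ 2 : ℝ) : ℂ) := by
    rw [h, ← inner_conj_symm g (b i)]
    push_cast
    rw [← Complex.conj_mul']
    ring
  rw [h1, Complex.ofReal_re]

variable (M)

/-- The compression of the transition operator to the unmarked states has a top eigenvector, and its
eigenvalue bounds all Rayleigh quotients over the unmarked states. -/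
theorem exists_isDirichlet_max [FiniteDimensional ℂ E] (hne : ∃ g, g ≠ 0 ∧ inner ℂ M.δ g = 0) :
    ∃ μ : ℝ, ∃ f : E, ‖f‖ = 1 ∧ M.IsDirichlet μ f ∧
      ∀ g, inner ℂ M.δ g = 0 → (inner ℂ g (M.A g)).re ≤ μ * ‖g‖ ^ 2 := by
  set K : Submodule ℂ E := LinearMap.ker (innerₛₗ ℂ M.δ) with hK
  have memK : ∀ g, g ∈ K ↔ inner ℂ M.δ g = 0 := fun g => by simp [hK]
  let D : K →ₗ[ℂ] K :=
    LinearMap.codRestrict K (M.proj ∘ₗ M.A ∘ₗ K.subtype) fun g => (memK _).2 (M.inner_δ_proj _)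
  have hDcoe : ∀ g : K, ((D g : K) : E) = M.proj (M.A g) := fun g => rfl
  have hD : D.IsSymmetric := by
    intro g h
    rw [Submodule.coe_inner, Submodule.coe_inner, hDcoe, hDcoe,
      M.inner_proj_right ((memK _).1 g.2), ← inner_conj_symm,
      M.inner_proj_right ((memK _).1 h.2), inner_conj_symm, inner_A]
  have : Nontrivial K := by
    obtain ⟨g, hg0, hg⟩ := hne
    exact ⟨⟨⟨g, (memK g).2 hg⟩, 0, fun h => hg0 (congrArg Subtype.val h)⟩⟩
  have : Nonempty (Fin (Module.finrank ℂ K)) := Fin.pos_iff_nonempty.1 Module.finrank_pos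
  set b := hD.eigenvectorBasis rfl with hb
  set ν := hD.eigenvalues rfl with hν
  obtain ⟨j, hj⟩ := Finite.exists_max ν
  have hbj : ∀ i, D (b i) = (ν i : ℂ) • b i := fun i => hD.apply_eigenvectorBasis rfl i
  refine ⟨ν j, b j, ?_, ⟨(memK _).1 (b j).2, ?_⟩, fun g hg => ?_⟩
  · exact b.orthonormal.1 j
  · have h := congrArg Subtype.val (hbj j)
    rw [hDcoe, proj_apply, Submodule.coe_smul] at h
    exact sub_eq_iff_eq_add.1 h
  · set g' : K := ⟨g, (memK g).2 hg⟩ with hg'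
    have h1 : inner ℂ g (M.A g) = inner ℂ g' (D g') := by
      rw [Submodule.coe_inner, hDcoe, M.inner_proj_right hg]
    have h2 := re_inner_eq_sum b D ν g' fun i => by
      rw [← hD (b i) g', hbj, inner_smul_left, Complex.conj_ofReal]
    have h3 : ‖g‖ ^ 2 = ∑ i, ‖inner ℂ (b i) g'‖ ^ 2 := by
      rw [b.sum_sq_norm_inner_right]; rfl
    rw [h1, h2, h3, Finset.mul_sum]
    exact Finset.sum_le_sum fun i _ => mul_le_mul_of_nonneg_right (hj i) (by positivity)

/-! ### The principal eigenvalue in terms of the spectrum of the random walk -/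

variable {E H : Type*} [NormedAddCommGroup E] [InnerProductSpace ℂ E]
  [NormedAddCommGroup H] [InnerProductSpace ℂ H]
  {ι : Type*} [Fintype ι]

/-- The spectral decomposition of the transition operator: an orthonormal eigenbasis `b` with real
eigenvalues `ℓ`, of which `ℓ k₀ = 1` is simple and largest, such that the marked state has the
same overlap `κ` with every eigenvector. -/
structure IsSpectral (M : SearchModel E H) (b : OrthonormalBasis ι ℂ E) (k₀ : ι) (ℓ : ι → ℝ)
    (κ : ℝ) : Prop where
  A_b : ∀ k, M.A (b k) = (ℓ k : ℂ) • b k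
  ℓ_zero : ℓ k₀ = 1
  ℓ_lt : ∀ k, k ≠ k₀ → ℓ k < 1
  κ_pos : 0 < κ
  norm_inner : ∀ k, ‖inner ℂ (b k) M.δ‖ = κ

variable {M : SearchModel E H} {b : OrthonormalBasis ι ℂ E} {k₀ : ι} {ℓ : ι → ℝ} {κ : ℝ}

theorem IsSpectral.inner_b_A (h : M.IsSpectral b k₀ ℓ κ) (k : ι) (g : E) :
    inner ℂ (b k) (M.A g) = ℓ k * inner ℂ (b k) g := by
  rw [← M.inner_A, h.A_b, inner_smul_left, Complex.conj_ofReal]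

theorem IsSpectral.inner_δ_eq_sum (h : M.IsSpectral b k₀ ℓ κ) (s : ι → ℂ) (g : E)
    (hg : ∀ k, inner ℂ (b k) g = s k * inner ℂ (b k) M.δ) :
    inner ℂ M.δ g = (κ : ℂ) ^ 2 * ∑ k, s k := by
  rw [← b.sum_inner_mul_inner M.δ g, Finset.mul_sum]
  refine Finset.sum_congr rfl fun k _ => ?_
  rw [hg, ← inner_conj_symm M.δ (b k), ← h.norm_inner k, ← Complex.conj_mul']
  ring

/-- The overlap of the evolved stationary state with the marked state comes from the principal
eigenvector `f`; the rest of the stationary state has norm `√(1 - |⟨b k₀, f⟩|²)`, which the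
evolution preserves. -/
theorem IsSpectral.norm_inner_U_pow_ge (h : M.IsSpectral b k₀ ℓ κ) {θ r : ℝ} {f : E}
    (hf : M.IsDirichlet (Real.cos θ) f) (h1 : ‖f‖ = 1) (hθ : 0 < Real.sin θ)
    (hnorm : ‖inner ℂ M.δ (M.A f)‖ * κ = (1 - Real.cos θ) * ‖inner ℂ (b k₀) f‖)
    (hr : 1 - r ^ 2 ≤ ‖inner ℂ (b k₀) f‖ ^ 2) (hr0 : 0 ≤ r) (n : ℕ)
    (hn : 0 ≤ Real.sin (n * θ)) :
    (1 - r ^ 2) * ((1 - Real.cos θ) / κ * (Real.sin (n * θ) / Real.sin θ)) - r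
      ≤ ‖inner ℂ (M.B M.δ) ((M.U ^ n) (M.B (b k₀)))‖ := by
  set e := b k₀ with he
  set c := inner ℂ f e with hc
  have hκ := h.κ_pos
  have hcnorm : ‖c‖ = ‖inner ℂ e f‖ := norm_inner_symm f e
  set v : E := e - c • f with hv
  have hvnorm : ‖v‖ ≤ r := by
    have hff : inner ℂ f f = 1 := by rw [inner_self_eq_norm_sq_to_K, h1]; simp
    have hee : inner ℂ e e = 1 := by
      rw [inner_self_eq_norm_sq_to_K, b.orthonormal.1]; simp
    have hef : inner ℂ e f = (starRingEnd ℂ) c := by rw [hc, inner_conj_symm]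
    have h2 : inner ℂ v v = ((1 - ‖c‖ ^ 2 : ℝ) : ℂ) := by
      rw [hv]
      simp only [inner_sub_left, inner_sub_right, inner_smul_left, inner_smul_right, hff, hee,
        hef, ← hc]
      push_cast
      rw [← Complex.conj_mul']
      ring
    have h3 : ‖v‖ ^ 2 = 1 - ‖c‖ ^ 2 := by
      have := inner_self_eq_norm_sq_to_K (𝕜 := ℂ) v
      rw [h2] at this
      exact_mod_cast (show ((1 - ‖c‖ ^ 2 : ℝ) : ℂ) = ((‖v‖ : ℝ) : ℂ) ^ 2 from this).symm
    have h4 : ‖v‖ ^ 2 ≤ r ^ 2 := by rw [h3, hcnorm]; linarith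
    exact (pow_le_pow_iff_left₀ (norm_nonneg _) hr0 two_ne_zero).1 h4
  have hdec : inner ℂ (M.B M.δ) ((M.U ^ n) (M.B e))
      = c * inner ℂ (M.B M.δ) ((M.U ^ n) (M.B f)) + inner ℂ (M.B M.δ) ((M.U ^ n) (M.B v)) := by
    rw [← inner_smul_right, ← inner_add_right, ← map_smul, ← map_smul, ← map_add, ← map_add, hv,
      add_sub_cancel]
  have hrest : ‖inner ℂ (M.B M.δ) ((M.U ^ n) (M.B v))‖ ≤ r := by
    refine (norm_inner_le_norm _ _).trans ?_
    rw [norm_U_pow, norm_B, norm_B, M.norm_δ, one_mul]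
    exact hvnorm
  -- the closed form of the Chebyshev polynomials
  have hmain : ‖c * inner ℂ (M.B M.δ) ((M.U ^ n) (M.B f))‖
      = ‖inner ℂ e f‖ ^ 2 * ((1 - Real.cos θ) / κ * (Real.sin (n * θ) / Real.sin θ)) := by
    have h5 := congrArg norm (hf.sin_mul_inner_U_pow n)
    rw [norm_mul, norm_mul, Complex.norm_real, Complex.norm_real, Real.norm_of_nonneg hθ.le,
      Real.norm_of_nonneg hn] at h5
    have h6 : ‖inner ℂ M.δ (M.A f)‖ = (1 - Real.cos θ) * ‖inner ℂ e f‖ / κ := by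
      rw [eq_div_iff hκ.ne', hnorm]
    rw [h6] at h5
    rw [norm_mul, hcnorm, ← mul_div_cancel_left₀ ‖inner ℂ (M.B M.δ) ((M.U ^ n) (M.B f))‖ hθ.ne',
      h5]
    field_simp
  have hnn : 0 ≤ (1 - Real.cos θ) / κ * (Real.sin (n * θ) / Real.sin θ) := by
    have := sub_nonneg.2 (Real.cos_le_one θ)
    positivity
  have h7 := norm_sub_le_norm_add (c * inner ℂ (M.B M.δ) ((M.U ^ n) (M.B f)))
    (inner ℂ (M.B M.δ) ((M.U ^ n) (M.B v)))
  rw [← hdec, hmain] at h7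
  have h8 := mul_le_mul_of_nonneg_right hr hnn
  linarith

variable [DecidableEq ι]

/-- `∑_{k ≠ k₀} 1 / (1 - ℓ_k)`. -/
noncomputable def resolventSum (ℓ : ι → ℝ) (k₀ : ι) : ℝ :=
  ∑ k ∈ Finset.univ.filter (fun k => k ≠ k₀), 1 / (1 - ℓ k)

/-- `∑_{k ≠ k₀} 1 / (1 - ℓ_k) ^ 2`. -/
noncomputable def resolventSqSum (ℓ : ι → ℝ) (k₀ : ι) : ℝ :=
  ∑ k ∈ Finset.univ.filter (fun k => k ≠ k₀), (1 / (1 - ℓ k)) ^ 2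

theorem sum_eq_add_sum_ne {α : Type*} [AddCommMonoid α] (k₀ : ι) (F : ι → α) :
    ∑ k, F k = F k₀ + ∑ k ∈ Finset.univ.filter (fun k => k ≠ k₀), F k := by
  rw [Finset.filter_ne' Finset.univ k₀, Finset.add_sum_erase _ _ (Finset.mem_univ k₀)]

/-- The trial vector `∑ s_k ⟨b_k, δ⟩ b_k` with `s_{k₀} = 1` and `s_k = -R⁻¹ (1 - ℓ_k)⁻¹` for
`k ≠ k₀` is orthogonal to the marked state, and its Rayleigh quotient is at least `1 - 1 / R`. -/
theorem IsSpectral.exists_trial (h : M.IsSpectral b k₀ ℓ κ) (hR : 0 < resolventSum ℓ k₀) :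
    ∃ g, g ≠ 0 ∧ inner ℂ M.δ g = 0 ∧
      (1 - 1 / resolventSum ℓ k₀) * ‖g‖ ^ 2 ≤ (inner ℂ g (M.A g)).re := by
  set R := resolventSum ℓ k₀ with hRdef
  set s : ι → ℝ := fun k => if k = k₀ then 1 else -(1 / R) * (1 / (1 - ℓ k)) with hs
  have hs0 : s k₀ = 1 := by simp [hs]
  have hs1 : ∀ k ∈ Finset.univ.filter (fun k => k ≠ k₀), s k = -(1 / R) * (1 / (1 - ℓ k)) := by
    intro k hk
    simp only [hs, if_neg (Finset.mem_filter.1 hk).2]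
  set g : E := ∑ k, ((s k : ℂ) * inner ℂ (b k) M.δ) • b k with hg
  have hgk : ∀ k, inner ℂ (b k) g = (s k : ℂ) * inner ℂ (b k) M.δ := fun k =>
    b.orthonormal.inner_right_fintype _ k
  have hnk : ∀ k, ‖inner ℂ (b k) g‖ ^ 2 = s k ^ 2 * κ ^ 2 := fun k => by
    rw [hgk, norm_mul, h.norm_inner, Complex.norm_real, mul_pow, Real.norm_eq_abs, sq_abs]
  have hnorm : ‖g‖ ^ 2 = ∑ k, s k ^ 2 * κ ^ 2 := by
    rw [← b.sum_sq_norm_inner_right g]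
    exact Finset.sum_congr rfl fun k _ => hnk k
  have hA : (inner ℂ g (M.A g)).re = ∑ k, ℓ k * (s k ^ 2 * κ ^ 2) := by
    rw [re_inner_eq_sum b M.A ℓ g fun k => h.inner_b_A k g]
    exact Finset.sum_congr rfl fun k _ => by rw [hnk]
  have hκ := h.κ_pos
  have hge : κ ^ 2 ≤ ‖g‖ ^ 2 := by
    rw [hnorm]
    have := Finset.single_le_sum (f := fun k => s k ^ 2 * κ ^ 2)
      (fun k _ => by positivity) (Finset.mem_univ k₀)
    simpa [hs0] using this
  have hdiff : ‖g‖ ^ 2 - (inner ℂ g (M.A g)).re = κ ^ 2 / R := by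
    rw [hnorm, hA, ← Finset.sum_sub_distrib, sum_eq_add_sum_ne k₀, h.ℓ_zero, one_mul, sub_self,
      zero_add]
    calc _ = ∑ k ∈ Finset.univ.filter (fun k => k ≠ k₀), κ ^ 2 / R ^ 2 * (1 / (1 - ℓ k)) := by
          refine Finset.sum_congr rfl fun k hk => ?_
          have := sub_pos.2 (h.ℓ_lt k (Finset.mem_filter.1 hk).2)
          rw [hs1 k hk]
          field_simp
      _ = _ := by
          rw [← Finset.mul_sum, ← resolventSum, ← hRdef]
          field_simp
  refine ⟨g, ?_, ?_, ?_⟩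
  · rintro h0
    rw [h0, norm_zero] at hge
    nlinarith
  · have h0 : ∑ k, s k = 0 := by
      rw [sum_eq_add_sum_ne k₀, hs0, Finset.sum_congr rfl hs1, ← Finset.mul_sum, ← resolventSum,
        ← hRdef]
      field_simp
      ring
    rw [h.inner_δ_eq_sum (fun k => (s k : ℂ)) g hgk, ← Complex.ofReal_sum, h0]
    simp
  · have : κ ^ 2 / R ≤ 1 / R * ‖g‖ ^ 2 := by
      rw [div_mul_eq_mul_div, one_mul]
      gcongr
    linarith

/-- For an eigenvalue `1 - x` of the killed walk which is much closer to `1` than the spectrum of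
the random walk, the secular equation `1 / x = ∑_{k ≠ k₀} 1 / (1 - ℓ_k - x)` bounds `x`, and the
eigenvector is close to the stationary state `b k₀`. -/
theorem IsSpectral.dirichlet_bounds (h : M.IsSpectral b k₀ ℓ κ) {x : ℝ} {f : E}
    (hf : M.IsDirichlet (1 - x) f) (h1 : ‖f‖ = 1) (hx : ∀ k, k ≠ k₀ → 2 * x ≤ 1 - ℓ k) :
    0 < x ∧ 1 ≤ 2 * x * resolventSum ℓ k₀ ∧
      ‖inner ℂ M.δ (M.A f)‖ * κ = x * ‖inner ℂ (b k₀) f‖ ∧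
      1 - 4 * x ^ 2 * resolventSqSum ℓ k₀ ≤ ‖inner ℂ (b k₀) f‖ ^ 2 := by
  set d := inner ℂ M.δ (M.A f) with hd
  have hκ := h.κ_pos
  have hne : ∀ k, inner ℂ (b k) M.δ ≠ 0 := fun k => by
    rw [← norm_ne_zero_iff, h.norm_inner]; exact hκ.ne'
  -- the eigenvalue equation in the basis `b`
  have hcoord : ∀ k, ((ℓ k : ℂ) - (1 - x)) * inner ℂ (b k) f = d * inner ℂ (b k) M.δ := by
    intro k
    have := congrArg (inner ℂ (b k)) hf.A_eq
    rw [h.inner_b_A, inner_add_right, inner_smul_right, inner_smul_right] at this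
    push_cast at this
    linear_combination this
  have hcoord0 : (x : ℂ) * inner ℂ (b k₀) f = d * inner ℂ (b k₀) M.δ := by
    have := hcoord k₀
    rw [h.ℓ_zero] at this
    push_cast at this
    linear_combination this
  have hgap : ∀ k, k ≠ k₀ → 0 < 1 - ℓ k - x ∧ 1 / (1 - ℓ k - x) ≤ 2 * (1 / (1 - ℓ k)) := by
    intro k hk
    have h2 := hx k hk
    have h3 := sub_pos.2 (h.ℓ_lt k hk)
    have h4 : 0 < 1 - ℓ k - x := by linarith
    refine ⟨h4, ?_⟩
    rw [mul_one_div, div_le_div_iff₀ h4 h3]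
    linarith
  have hk : ∀ k, k ≠ k₀ → inner ℂ (b k) f
      = -(d * ((1 / (1 - ℓ k - x) : ℝ) : ℂ)) * inner ℂ (b k) M.δ := by
    intro k hk
    have h4 : ((1 - ℓ k - x : ℝ) : ℂ) ≠ 0 := by exact_mod_cast (hgap k hk).1.ne'
    have := hcoord k
    rw [Complex.ofReal_div, Complex.ofReal_one]
    field_simp
    push_cast
    linear_combination -this
  -- if `d = 0` then `f` is a multiple of `b k₀`, which is not orthogonal to the marked state
  have hd0 : d ≠ 0 := by
    intro h0
    have hk0 : ∀ k, k ≠ k₀ → inner ℂ (b k) f = 0 := fun k hk' => by rw [hk k hk', h0]; simp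
    have hsum := b.sum_inner_mul_inner M.δ f
    rw [sum_eq_add_sum_ne k₀, Finset.sum_eq_zero (fun k hk' => by
      rw [hk0 k (Finset.mem_filter.1 hk').2, mul_zero]), add_zero, hf.inner_eq_zero] at hsum
    have h5 : inner ℂ (b k₀) f = 0 := by
      refine (mul_eq_zero.1 hsum).resolve_left ?_
      rw [← inner_conj_symm]
      exact fun h6 => hne k₀ ((map_eq_zero _).1 h6)
    have h7 := b.sum_sq_norm_inner_right f
    rw [sum_eq_add_sum_ne k₀, Finset.sum_eq_zero (fun k hk' => by
      rw [hk0 k (Finset.mem_filter.1 hk').2, norm_zero, zero_pow two_ne_zero]), h5, h1] at h7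
    simp at h7
  -- the secular equation: `⟨δ, f⟩ = 0` in the basis `b`, divided by `d`
  have hsec : x * ∑ k ∈ Finset.univ.filter (fun k => k ≠ k₀), 1 / (1 - ℓ k - x) = 1 := by
    have hsum := b.sum_inner_mul_inner M.δ f
    rw [sum_eq_add_sum_ne k₀, hf.inner_eq_zero] at hsum
    have hconj : ∀ k, inner ℂ M.δ (b k) * inner ℂ (b k) M.δ = (κ : ℂ) ^ 2 := fun k => by
      rw [← inner_conj_symm, ← h.norm_inner k, ← Complex.conj_mul']
    have hsum' : ∑ k ∈ Finset.univ.filter (fun k => k ≠ k₀), inner ℂ M.δ (b k) * inner ℂ (b k) f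
        = -(d * (κ : ℂ) ^ 2)
          * ((∑ k ∈ Finset.univ.filter (fun k => k ≠ k₀), 1 / (1 - ℓ k - x) : ℝ) : ℂ) := by
      rw [Complex.ofReal_sum, Finset.mul_sum]
      refine Finset.sum_congr rfl fun k hk' => ?_
      rw [hk k (Finset.mem_filter.1 hk').2, ← hconj k]
      ring
    rw [hsum'] at hsum
    have h8 : d * (κ : ℂ) ^ 2
        * (1 - x * ((∑ k ∈ Finset.univ.filter (fun k => k ≠ k₀), 1 / (1 - ℓ k - x) : ℝ) : ℂ))
        = 0 := by
      have h9 := hconj k₀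
      linear_combination (x : ℂ) * hsum - inner ℂ M.δ (b k₀) * hcoord0 - d * h9
    have h10 : (κ : ℂ) ^ 2 ≠ 0 := by
      have : (κ : ℂ) ≠ 0 := by exact_mod_cast hκ.ne'
      exact pow_ne_zero 2 this
    have h11 := (mul_eq_zero.1 h8).resolve_left (mul_ne_zero hd0 h10)
    have h12 := sub_eq_zero.1 h11
    rw [← Complex.ofReal_mul] at h12
    exact_mod_cast h12.symm
  have hSnn : 0 ≤ ∑ k ∈ Finset.univ.filter (fun k => k ≠ k₀), 1 / (1 - ℓ k - x) :=
    Finset.sum_nonneg fun k hk' =>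
      one_div_nonneg.2 (hgap k (Finset.mem_filter.1 hk').2).1.le
  have hxpos : 0 < x := by
    by_contra hx0
    have := mul_nonneg (neg_nonneg.2 (not_lt.1 hx0)) hSnn
    linarith
  have hnorm0 : ‖d‖ * κ = x * ‖inner ℂ (b k₀) f‖ := by
    have := congrArg norm hcoord0
    rw [norm_mul, norm_mul, h.norm_inner, Complex.norm_real, Real.norm_of_nonneg hxpos.le] at this
    exact this.symm
  have hc1 : ‖inner ℂ (b k₀) f‖ ≤ 1 := by
    have := norm_inner_le_norm (𝕜 := ℂ) (b k₀) f
    rwa [b.orthonormal.1, h1, one_mul] at this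
  refine ⟨hxpos, ?_, hnorm0, ?_⟩
  · rw [← hsec]
    have : ∑ k ∈ Finset.univ.filter (fun k => k ≠ k₀), 1 / (1 - ℓ k - x)
        ≤ 2 * resolventSum ℓ k₀ := by
      rw [resolventSum, Finset.mul_sum]
      exact Finset.sum_le_sum fun k hk' => (hgap k (Finset.mem_filter.1 hk').2).2
    nlinarith
  · have h7 := b.sum_sq_norm_inner_right f
    rw [sum_eq_add_sum_ne k₀, h1, one_pow] at h7
    have h13 : ∑ k ∈ Finset.univ.filter (fun k => k ≠ k₀), ‖inner ℂ (b k) f‖ ^ 2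
        ≤ 4 * x ^ 2 * resolventSqSum ℓ k₀ := by
      rw [resolventSqSum, Finset.mul_sum]
      refine Finset.sum_le_sum fun k hk' => ?_
      have hk'' := (Finset.mem_filter.1 hk').2
      obtain ⟨hg1, hg2⟩ := hgap k hk''
      have hg3 := sub_pos.2 (h.ℓ_lt k hk'')
      have h14 : ‖inner ℂ (b k) f‖ ≤ x * (2 * (1 / (1 - ℓ k))) := by
        rw [hk k hk'', norm_mul, norm_neg, norm_mul, h.norm_inner, Complex.norm_real,
          Real.norm_of_nonneg (by positivity)]
        calc _ = (‖d‖ * κ) * (1 / (1 - ℓ k - x)) := by ring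
          _ ≤ x * (2 * (1 / (1 - ℓ k))) := by
            rw [hnorm0]
            refine mul_le_mul ?_ hg2 (by positivity) hxpos.le
            nlinarith
      calc _ ≤ (x * (2 * (1 / (1 - ℓ k)))) ^ 2 := by gcongr
        _ = _ := by ring
    linarith

/-- The least eigenphase `θ` of the search operator and the overlap of the evolved stationary state
with the marked state, in terms of the resolvent sums `R` and `R₂` of the random walk. -/
theorem IsSpectral.exists_least_eigenphase [FiniteDimensional ℂ E] (h : M.IsSpectral b k₀ ℓ κ)
    (hR : 1 ≤ resolventSum ℓ k₀)
    (hR2 : 8 * resolventSqSum ℓ k₀ ≤ resolventSum ℓ k₀ ^ 2) :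
    ∃ θ : ℝ, IsLeast {θ : ℝ | 0 < θ ∧ θ ≤ Real.pi ∧
        Module.End.HasEigenvalue M.U (Complex.exp (Complex.I * (θ : ℂ)))} θ ∧
      θ < Real.pi ∧
      1 / (2 * resolventSum ℓ k₀) ≤ 1 - Real.cos θ ∧ 1 - Real.cos θ ≤ 1 / resolventSum ℓ k₀ ∧
      ∀ n : ℕ, 0 ≤ Real.sin (n * θ) →
        1 / 2 * ((1 - Real.cos θ) / κ * (Real.sin (n * θ) / Real.sin θ))
            - 2 * (Real.sqrt (resolventSqSum ℓ k₀) / resolventSum ℓ k₀)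
          ≤ ‖inner ℂ (M.B M.δ) ((M.U ^ n) (M.B (b k₀)))‖ := by
  set R := resolventSum ℓ k₀ with hRdef
  set R₂ := resolventSqSum ℓ k₀ with hR2def
  have hR0 : 0 < R := by linarith
  obtain ⟨g, hg0, hgδ, hg⟩ := h.exists_trial hR0
  obtain ⟨μ, f, h1, hf, hmax⟩ := M.exists_isDirichlet_max ⟨g, hg0, hgδ⟩
  set x := 1 - μ with hxdef
  have hxR : x ≤ 1 / R := by
    have h2 := hg.trans (hmax g hgδ)
    have h3 : 0 < ‖g‖ ^ 2 := by positivity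
    have h4 := le_of_mul_le_mul_right h2 h3
    rw [hxdef]; linarith
  -- `1 / (1 - ℓ_k) ≤ √R₂ ≤ R / 2` for each single `k ≠ k₀`
  have hgap : ∀ k, k ≠ k₀ → 2 * x ≤ 1 - ℓ k := by
    intro k hk
    have h3 := sub_pos.2 (h.ℓ_lt k hk)
    have h4 : (1 / (1 - ℓ k)) ^ 2 ≤ R₂ :=
      Finset.single_le_sum (f := fun k => (1 / (1 - ℓ k)) ^ 2) (fun k _ => by positivity)
        (Finset.mem_filter.2 ⟨Finset.mem_univ k, hk⟩)
    have h5 : (1 / (1 - ℓ k)) ≤ R / 2 := by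
      refine (pow_le_pow_iff_left₀ (by positivity) (by positivity) two_ne_zero).1 ?_
      have h6 : (R / 2) ^ 2 = R ^ 2 / 4 := by ring
      have h7 : 0 ≤ R ^ 2 := sq_nonneg R
      rw [h6]; linarith
    have h6 : 2 / R ≤ 1 - ℓ k := by
      rw [div_le_iff₀ h3] at h5
      rw [div_le_iff₀ hR0]; linarith
    have h7 : 2 * (1 / R) = 2 / R := by ring
    linarith
  have hf' : M.IsDirichlet (1 - x) f := by rw [hxdef, sub_sub_cancel]; exact hf
  obtain ⟨hx0, hxlow, hdn, hc⟩ := h.dirichlet_bounds hf' h1 hgap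
  have hR1 : 1 / R ≤ 1 := by rw [div_le_one hR0]; exact hR
  set θ := Real.arccos μ with hθ
  have hcos : Real.cos θ = μ := Real.cos_arccos (by linarith) (by linarith)
  have hθ0 : 0 < θ := Real.arccos_pos.2 (by linarith)
  have hθpi : θ < Real.pi := by
    refine lt_of_le_of_ne (Real.arccos_le_pi μ) fun h2 => ?_
    rw [h2, Real.cos_pi] at hcos
    linarith
  have hsin : 0 < Real.sin θ := Real.sin_pos_of_pos_of_lt_pi hθ0 hθpi
  have hf'' : M.IsDirichlet (Real.cos θ) f := by rw [hcos]; exact hf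
  have hx1 : 1 - Real.cos θ = x := by rw [hcos]
  have hR2nn : 0 ≤ R₂ := Finset.sum_nonneg fun k _ => sq_nonneg _
  refine ⟨θ, ⟨⟨hθ0, hθpi.le, hf''.hasEigenvalue h1 hsin.ne'⟩, fun φ ⟨hφ0, hφpi, hφ⟩ => ?_⟩,
    hθpi, ?_, by rw [hx1]; exact hxR, fun n hn => ?_⟩
  · rcases hφpi.eq_or_lt with rfl | hlt
    · exact hθpi.le
    · have h2 := cos_le_of_hasEigenvalue (Real.sin_pos_of_pos_of_lt_pi hφ0 hlt) hmax hφ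
      rw [hθ, ← Real.arccos_cos hφ0.le hφpi]
      exact Real.arccos_le_arccos h2
  · rw [hx1, div_le_iff₀ (by positivity)]
    linarith
  · set r := 2 * x * Real.sqrt R₂ with hr
    have hrsq : r ^ 2 = 4 * x ^ 2 * R₂ := by
      rw [hr, mul_pow, mul_pow, Real.sq_sqrt hR2nn]; ring
    have h2 := h.norm_inner_U_pow_ge (r := r) hf'' h1 hsin (by rw [hx1]; exact hdn)
      (by rw [hrsq]; exact hc) (by positivity) n hn
    have h3 : r ≤ 2 * (Real.sqrt R₂ / R) := by
      calc r = 2 * (Real.sqrt R₂ * x) := by rw [hr]; ring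
        _ ≤ 2 * (Real.sqrt R₂ * (1 / R)) := by gcongr
        _ = _ := by ring
    have h4 : r ^ 2 ≤ 1 / 2 := by
      have h5 : x * R ≤ 1 := by rwa [le_div_iff₀ hR0] at hxR
      have h6 : (x * R) ^ 2 ≤ 1 := pow_le_one₀ (by positivity) h5
      rw [hrsq]
      nlinarith [sq_nonneg x, mul_le_mul_of_nonneg_left hR2 (sq_nonneg x)]
    have h7 : 0 ≤ (1 - Real.cos θ) / κ * (Real.sin (n * θ) / Real.sin θ) := by
      have := sub_nonneg.2 (Real.cos_le_one θ)
      have := h.κ_pos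
      positivity
    have h8 := mul_le_mul_of_nonneg_right (show (1 / 2 : ℝ) ≤ 1 - r ^ 2 by linarith) h7
    linarith

end SearchModel

/-! ### The walk on the grid as a search model -/

/-- The normalization `d^(-t/2)` of the coin states. -/
noncomputable def coinNorm (t : ℕ) : ℂ := (((Real.sqrt (4 ^ t))⁻¹ : ℝ) : ℂ)

theorem coinNorm_mul_self (t : ℕ) : coinNorm t * coinNorm t * (4 : ℂ) ^ t = 1 := by
  have h : (0 : ℝ) < 4 ^ t := by positivity
  have h2 : (Real.sqrt (4 ^ t))⁻¹ * (Real.sqrt (4 ^ t))⁻¹ * (4 : ℝ) ^ t = 1 := by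
    rw [← mul_inv, Real.mul_self_sqrt h.le, inv_mul_cancel₀ h.ne']
  rw [coinNorm, ← Complex.ofReal_mul]
  exact_mod_cast congrArg (fun x : ℝ => (x : ℂ)) h2

theorem conj_coinNorm (t : ℕ) : (starRingEnd ℂ) (coinNorm t) = coinNorm t := Complex.conj_ofReal _

theorem card_dir : Fintype.card Dir = 4 := rfl

variable {L t : ℕ} [NeZero L]

theorem basisMap_apply {f : Label L t → Label L t} (hf : ∀ s, f (f s) = s) (w : Space L t)
    (s : Label L t) : basisMap f w s = w (f s) := by
  have key : basisMap f = (LinearMap.mk ⟨fun w : Space L t => WithLp.toLp 2 fun s => w (f s),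
      fun v w => rfl⟩ fun c w => rfl : Module.End ℂ (Space L t)) := by
    refine end_ext_ket fun s' => ?_
    ext s
    rw [basisMap_ket]
    have h : s = f s' ↔ f s = s' := ⟨fun h => by rw [h, hf], fun h => by rw [← h, hf]⟩
    change (EuclideanSpace.single (f s') (1 : ℂ) : Space L t) s
      = (EuclideanSpace.single s' (1 : ℂ) : Space L t) (f s)
    simp [h]
  rw [key]
  rfl

theorem shift_apply (w : Space L t) (s : Label L t) : shift L t w s = w (powerRot s) :=
  basisMap_apply powerRot_powerRot w s

theorem psi_apply (u : Vertex L) (s : Label L t) :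
    psi t u s = if s.1 = u then coinNorm t else 0 := by
  obtain ⟨v, h⟩ := s
  simp only [psi, ket, PiLp.smul_apply, WithLp.ofLp_sum, Finset.sum_apply, smul_eq_mul]
  simp only [PiLp.single_apply, Prod.mk.injEq]
  by_cases hv : v = u <;> simp [hv, coinNorm]

/-- The isometry which sends the vertex `u` to the state `|ψ_u⟩`. -/
noncomputable def gridB (L t : ℕ) [NeZero L] : EuclideanSpace ℂ (Vertex L) →ₗ[ℂ] Space L t where
  toFun f := WithLp.toLp 2 fun s => coinNorm t * f s.1
  map_add' f g := by ext s; simp [mul_add]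
  map_smul' c f := by ext s; simp [mul_left_comm]

/-- The adjoint of `gridB`. -/
noncomputable def gridC (L t : ℕ) [NeZero L] : Space L t →ₗ[ℂ] EuclideanSpace ℂ (Vertex L) where
  toFun w := WithLp.toLp 2 fun u => ∑ g : Fin t → Dir, coinNorm t * w (u, g)
  map_add' f g := by ext s; simp [mul_add, Finset.sum_add_distrib]
  map_smul' c f := by ext s; simp [mul_left_comm, Finset.mul_sum]

theorem gridB_apply (f : EuclideanSpace ℂ (Vertex L)) (s : Label L t) :
    gridB L t f s = coinNorm t * f s.1 := rfl

theorem gridC_apply (w : Space L t) (u : Vertex L) :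
    gridC L t w u = ∑ g : Fin t → Dir, coinNorm t * w (u, g) := rfl

/-- The search model of the multi-step walk on the grid with marked vertex `m`. -/
noncomputable def gridModel (t : ℕ) (m : Vertex L) :
    SearchModel (EuclideanSpace ℂ (Vertex L)) (Space L t) where
  B := gridB L t
  C := gridC L t
  S := shift L t
  δ := EuclideanSpace.single m 1
  inner_B f w := by
    simp only [PiLp.inner_apply, gridB_apply, gridC_apply, RCLike.inner_apply]
    rw [Fintype.sum_prod_type]
    refine Finset.sum_congr rfl fun u _ => ?_
    rw [Finset.sum_mul]
    refine Finset.sum_congr rfl fun g _ => ?_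
    rw [map_mul, conj_coinNorm]
    ring
  C_B f := by
    ext u
    simp only [gridC_apply, gridB_apply]
    rw [Finset.sum_const, Finset.card_univ, Fintype.card_fun, card_dir, Fintype.card_fin,
      nsmul_eq_mul]
    push_cast
    linear_combination f u * coinNorm_mul_self t
  inner_S v w := by
    simp only [PiLp.inner_apply, shift_apply]
    refine Fintype.sum_bijective powerRot (Function.Involutive.bijective powerRot_powerRot) _ _
      fun s => ?_
    rw [powerRot_powerRot]
  S_S w := by
    ext s
    rw [shift_apply, shift_apply, powerRot_powerRot]
  norm_δ := by simp

theorem psi_eq (u : Vertex L) : psi t u = gridB L t (EuclideanSpace.single u 1) := by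
  ext s
  rw [psi_apply, gridB_apply]
  simp

theorem inner_psi (u : Vertex L) (w : Space L t) : inner ℂ (psi t u) w = gridC L t w u := by
  rw [psi_eq]
  refine ((gridModel t u).inner_B (EuclideanSpace.single u 1) w).trans ?_
  change inner ℂ (EuclideanSpace.single u 1) (gridC L t w) = _
  rw [EuclideanSpace.inner_single_left, map_one, one_mul]

theorem sum_smul_psi (f : EuclideanSpace ℂ (Vertex L)) :
    ∑ u, f u • psi t u = gridB L t f := by
  ext s
  simp only [WithLp.ofLp_sum, Finset.sum_apply, PiLp.smul_apply, psi_apply, gridB_apply,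
    smul_eq_mul]
  simp [mul_comm]

theorem searchOp_eq (t : ℕ) (m : Vertex L) : searchOp t m = (gridModel t m).U := by
  have hC : ∀ w, gridC L t w m = inner ℂ (gridModel t m).δ (gridC L t w) := fun w => by
    change _ = inner ℂ (EuclideanSpace.single m 1) (gridC L t w)
    rw [EuclideanSpace.inner_single_left, map_one, one_mul]
  have hcoin : ∀ w : Space L t, coin L t w = (2 : ℂ) • gridB L t (gridC L t w) - w := fun w => by
    rw [← sum_smul_psi]
    simp [coin, ketBra, inner_psi]
  refine LinearMap.ext fun w => ?_
  have horacle : oracle t m w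
      = w - (2 * inner ℂ (gridModel t m).δ (gridC L t w)) • gridB L t (gridModel t m).δ := by
    have : psi t m = gridB L t (gridModel t m).δ := psi_eq m
    rw [← this, ← hC, ← inner_psi]
    simp [oracle, ketBra, smul_smul]
  rw [SearchModel.U_apply, searchOp, walk, Module.End.mul_apply, Module.End.mul_apply, hcoin,
    horacle]
  change shift L t _ = shift L t ((2 : ℂ) • gridB L t ((gridModel t m).proj (gridC L t w)) - w)
  have hCB : gridC L t (gridB L t (gridModel t m).δ) = (gridModel t m).δ := (gridModel t m).C_B _
  rw [SearchModel.proj_apply]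
  congr 1
  simp only [map_sub, map_smul, hCB]
  module

/-! ### Diagonalization of the random walk -/

/-- The displacement of a step in the direction `g`. -/
def step (L : ℕ) : Dir → Vertex L
  | Dir.right => (1, 0)
  | Dir.left => (-1, 0)
  | Dir.up => (0, 1)
  | Dir.down => (0, -1)

theorem rot_fst {L : ℕ} (u : Vertex L) (g : Dir) : (rot (u, g)).1 = u + step L g := by
  obtain ⟨x, y⟩ := u
  cases g <;> simp [rot, step, sub_eq_add_neg]

theorem pathVertex_eq {L t : ℕ} (u : Vertex L) (g : Fin t → Dir) :
    pathVertex u g t = u + ∑ i, step L (g i) := by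
  have h : ∀ n, n ≤ t → pathVertex u g n
      = u + ∑ j ∈ Finset.range n, if h : j < t then step L (g ⟨j, h⟩) else 0 := by
    intro n
    induction n with
    | zero => simp [pathVertex]
    | succ n ih =>
      intro hn
      rw [pathVertex_succ _ _ hn, rot_fst, ih (Nat.le_of_succ_le hn), Finset.sum_range_succ,
        dif_pos (show n < t from hn), add_assoc]
  rw [h t le_rfl, Finset.sum_range]
  simp

/-- The character `u ↦ exp (2πi (k₁ u₁ + k₂ u₂) / L)` of the grid. -/
noncomputable def gridChar (k : Vertex L) : AddChar (Vertex L) ℂ :=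
  ZMod.stdAddChar.compAddMonoidHom
    ((AddMonoidHom.mulLeft k.1).coprod (AddMonoidHom.mulLeft k.2))

theorem gridChar_apply (k u : Vertex L) :
    gridChar k u = ZMod.stdAddChar (k.1 * u.1) * ZMod.stdAddChar (k.2 * u.2) := by
  rw [← AddChar.map_add_eq_mul]
  rfl

theorem gridChar_sum {α : Type*} (k : Vertex L) (s : Finset α) (f : α → Vertex L) :
    gridChar k (∑ i ∈ s, f i) = ∏ i ∈ s, gridChar k (f i) := by
  classical
  induction s using Finset.induction_on with
  | empty => simp
  | insert i s hi ih =>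
    rw [Finset.sum_insert hi, Finset.prod_insert hi, AddChar.map_add_eq_mul, ih]

theorem conj_stdAddChar (j : ZMod L) :
    (starRingEnd ℂ) (ZMod.stdAddChar j) = ZMod.stdAddChar (-j) := by
  rw [AddChar.map_neg_eq_conj]

theorem norm_gridChar (k u : Vertex L) : ‖gridChar k u‖ = 1 := AddChar.norm_apply _ _

theorem stdAddChar_add_stdAddChar_neg (j : ZMod L) :
    ZMod.stdAddChar j + ZMod.stdAddChar (-j)
      = ((2 - 4 * Real.sin (Real.pi * j.val / L) ^ 2 : ℝ) : ℂ) := by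
  have h1 : ZMod.stdAddChar j = Complex.exp (2 * Real.pi * Complex.I * j.val / L) := by
    have := ZMod.stdAddChar_coe (N := L) (j.val : ℤ)
    simpa using this
  have h2 : (2 * Real.pi * Complex.I * j.val / L : ℂ)
      = ((2 * (Real.pi * j.val / L) : ℝ) : ℂ) * Complex.I := by
    push_cast; ring
  have h3 : 2 - 4 * Real.sin (Real.pi * j.val / L) ^ 2
      = 2 * Real.cos (2 * (Real.pi * j.val / L)) := by
    rw [Real.cos_two_mul, Real.cos_sq']; ring
  rw [← conj_stdAddChar, Complex.add_conj, h1, h2, Complex.exp_ofReal_mul_I_re, h3]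

/-- The eigenvalue of `1 - P`, with `P` the simple random walk on the grid, at the `k`-th
character. -/
noncomputable def gridGap (k : Vertex L) : ℝ :=
  Real.sin (Real.pi * k.1.val / L) ^ 2 + Real.sin (Real.pi * k.2.val / L) ^ 2

theorem sum_gridChar_step (k : Vertex L) :
    ∑ g, gridChar k (step L g) = 4 * ((1 - gridGap k : ℝ) : ℂ) := by
  have h : ∑ g, gridChar k (step L g)
      = (ZMod.stdAddChar k.1 + ZMod.stdAddChar (-k.1))
        + (ZMod.stdAddChar k.2 + ZMod.stdAddChar (-k.2)) := by
    have huniv : (Finset.univ : Finset Dir) = {Dir.right, Dir.left, Dir.up, Dir.down} := rfl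
    rw [huniv]
    simp [gridChar_apply, step]
    ring
  rw [h, stdAddChar_add_stdAddChar_neg, stdAddChar_add_stdAddChar_neg, gridGap]
  push_cast
  ring

theorem gridModel_A_apply (m : Vertex L) (f : EuclideanSpace ℂ (Vertex L)) (u : Vertex L) :
    (gridModel t m).A f u
      = coinNorm t * coinNorm t * ∑ g : Fin t → Dir, f (u + ∑ i, step L (g i)) := by
  change gridC L t (shift L t (gridB L t f)) u = _
  rw [gridC_apply, Finset.mul_sum]
  refine Finset.sum_congr rfl fun g _ => ?_
  rw [shift_apply, gridB_apply, ← pathVertex_eq]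
  simp only [powerRot]
  ring

/-- The normalized characters. -/
noncomputable def charVec (k : Vertex L) : EuclideanSpace ℂ (Vertex L) :=
  WithLp.toLp 2 fun u => (L : ℂ)⁻¹ * gridChar k u

theorem charVec_apply (k u : Vertex L) : charVec k u = (L : ℂ)⁻¹ * gridChar k u := rfl

theorem gridModel_A_charVec (m k : Vertex L) :
    (gridModel t m).A (charVec k) = (((1 - gridGap k) ^ t : ℝ) : ℂ) • charVec k := by
  ext u
  have h : ∑ g : Fin t → Dir, ∏ i, gridChar k (step L (g i))
      = (4 * ((1 - gridGap k : ℝ) : ℂ)) ^ t := by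
    rw [← sum_gridChar_step, ← Fin.prod_const, Finset.prod_univ_sum, Fintype.piFinset_univ]
  rw [gridModel_A_apply, PiLp.smul_apply, smul_eq_mul]
  simp only [charVec_apply, AddChar.map_add_eq_mul, gridChar_sum]
  rw [← Finset.mul_sum, ← Finset.mul_sum, h, mul_pow]
  push_cast
  linear_combination ((L : ℂ)⁻¹ * gridChar k u * (1 - (gridGap k : ℂ)) ^ t) * coinNorm_mul_self t

theorem sum_stdAddChar_mul (a b : ZMod L) :
    ∑ x, (starRingEnd ℂ) (ZMod.stdAddChar (a * x)) * ZMod.stdAddChar (b * x)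
      = if a = b then (L : ℂ) else 0 := by
  have h := AddChar.sum_mulShift (b - a) (ZMod.isPrimitive_stdAddChar L)
  rw [ZMod.card] at h
  have h2 : b - a = 0 ↔ a = b := by rw [sub_eq_zero, eq_comm]
  simp only [h2] at h
  rw [Nat.cast_ite, Nat.cast_zero] at h
  rw [← h]
  refine Finset.sum_congr rfl fun x _ => ?_
  rw [conj_stdAddChar, ← AddChar.map_add_eq_mul]
  congr 1
  ring

theorem orthonormal_charVec : Orthonormal ℂ (charVec (L := L)) := by
  rw [orthonormal_iff_ite]
  intro k k'
  have hL : (L : ℂ) ≠ 0 := Nat.cast_ne_zero.2 (NeZero.ne L)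
  have h : inner ℂ (charVec k) (charVec k') = (L : ℂ)⁻¹ ^ 2 *
      ((∑ x, (starRingEnd ℂ) (ZMod.stdAddChar (k.1 * x)) * ZMod.stdAddChar (k'.1 * x)) *
        ∑ y, (starRingEnd ℂ) (ZMod.stdAddChar (k.2 * y)) * ZMod.stdAddChar (k'.2 * y)) := by
    rw [Finset.sum_mul_sum, PiLp.inner_apply, Fintype.sum_prod_type, Finset.mul_sum]
    refine Finset.sum_congr rfl fun x _ => ?_
    rw [Finset.mul_sum]
    refine Finset.sum_congr rfl fun y _ => ?_
    simp only [RCLike.inner_apply, charVec_apply, gridChar_apply, map_mul, map_inv₀, map_natCast]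
    ring
  rw [h, sum_stdAddChar_mul, sum_stdAddChar_mul]
  by_cases h1 : k.1 = k'.1
  · by_cases h2 : k.2 = k'.2
    · rw [if_pos h1, if_pos h2, if_pos (Prod.ext h1 h2)]
      field_simp
    · rw [if_neg h2, if_neg fun h => h2 (congrArg Prod.snd h)]; simp
  · rw [if_neg h1, if_neg fun h => h1 (congrArg Prod.fst h)]; simp

/-- The orthonormal basis of characters. -/
noncomputable def charBasis (L : ℕ) [NeZero L] :
    OrthonormalBasis (Vertex L) ℂ (EuclideanSpace ℂ (Vertex L)) :=
  OrthonormalBasis.mk orthonormal_charVec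
    (orthonormal_charVec.linearIndependent.span_eq_top_of_card_eq_finrank' (by simp)).ge

theorem charBasis_apply (k : Vertex L) : charBasis L k = charVec k := by
  rw [charBasis, OrthonormalBasis.coe_mk]

theorem startState_eq (t : ℕ) : startState L t = gridB L t (charBasis L 0) := by
  have hL : (0 : ℝ) ≤ L := L.cast_nonneg
  rw [startState, ← sum_smul_psi, Finset.smul_sum, charBasis_apply]
  refine Finset.sum_congr rfl fun u _ => ?_
  rw [charVec_apply, gridChar_apply, Real.sqrt_sq hL]
  simp

theorem one_sub_pow_bounds {y : ℝ} {t : ℕ} (h0 : 0 < y) (h2 : y ≤ 2) (ht : Odd t) :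
    0 < 1 - (1 - y) ^ t ∧ 1 - (1 - y) ^ t ≤ t * y ∧
      1 / (1 - (1 - y) ^ t) ≤ 1 + 1 / (t * y) := by
  have htpos : (0 : ℝ) < t := by exact_mod_cast ht.pos
  have hty : 0 < t * y := mul_pos htpos h0
  have hup : 1 - (1 - y) ^ t ≤ t * y := by
    have := one_add_mul_le_pow (a := -y) (by linarith) t
    rw [← sub_eq_add_neg] at this
    linarith
  -- Bernoulli's inequality for `(1 + y) ^ t` if `y ≤ 1`; otherwise `(1 - y) ^ t ≤ 0`, as `t` is odd
  have hlow : t * y / (1 + t * y) ≤ 1 - (1 - y) ^ t := by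
    have h3 : (1 - y) ^ t ≤ 1 / (1 + t * y) := by
      rcases le_total y 1 with h1 | h1
      · rw [le_div_iff₀ (by linarith)]
        have h4 : 1 + t * y ≤ (1 + y) ^ t := one_add_mul_le_pow (by linarith) t
        have h5 : (1 - y) ^ t * (1 + y) ^ t ≤ 1 := by
          rw [← mul_pow]
          exact pow_le_one₀ (by nlinarith) (by nlinarith)
        exact (mul_le_mul_of_nonneg_left h4 (pow_nonneg (by linarith) t)).trans h5
      · exact (ht.pow_nonpos (by linarith)).trans (by positivity)
    have h4 : t * y / (1 + t * y) = 1 - 1 / (1 + t * y) := by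
      field_simp
      ring
    rw [h4]
    linarith
  have hpos : 0 < t * y / (1 + t * y) := by positivity
  refine ⟨hpos.trans_le hlow, hup, ?_⟩
  calc _ ≤ 1 / (t * y / (1 + t * y)) := one_div_le_one_div_of_le hpos hlow
    _ = _ := by field_simp; ring

theorem sin_sq_le {L : ℕ} (j : ZMod L) :
    Real.sin (Real.pi * j.val / L) ^ 2 ≤ Real.pi ^ 2 * (j.val : ℝ) ^ 2 / (L : ℝ) ^ 2 := by
  calc _ ≤ (Real.pi * j.val / L) ^ 2 := Real.sin_sq_le_sq
    _ = _ := by ring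

theorem le_sin_sq (j : ZMod L) :
    4 * (cycleNorm j : ℝ) ^ 2 / (L : ℝ) ^ 2 ≤ Real.sin (Real.pi * j.val / L) ^ 2 := by
  have hL : (0 : ℝ) < L := Nat.cast_pos.2 (NeZero.pos L)
  have hj := (ZMod.val_lt j).le
  have hpi := Real.pi_pos
  -- reflect the angle into `[0, π / 2]`
  have hsin : Real.sin (Real.pi * cycleNorm j / L) = Real.sin (Real.pi * j.val / L) := by
    rw [cycleNorm]
    rcases min_choice j.val (L - j.val) with h | h <;> rw [h]
    rw [Nat.cast_sub hj, ← Real.sin_pi_sub (Real.pi * j.val / L)]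
    congr 1
    field_simp
  have hle : (cycleNorm j : ℝ) ≤ L / 2 := by
    rw [le_div_iff₀ zero_lt_two]
    have : cycleNorm j * 2 ≤ L := by unfold cycleNorm; omega
    exact_mod_cast this
  have h1 := Real.mul_le_sin (x := Real.pi * cycleNorm j / L) (by positivity) (by
    rw [div_le_iff₀ hL]
    nlinarith)
  rw [hsin] at h1
  calc _ = (2 / Real.pi * (Real.pi * cycleNorm j / L)) ^ 2 := by
        field_simp
        ring
    _ ≤ _ := by gcongr

theorem gridGap_le_two {L : ℕ} (k : Vertex L) : gridGap k ≤ 2 := by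
  have h1 := Real.sin_sq_le_one (Real.pi * k.1.val / L)
  have h2 := Real.sin_sq_le_one (Real.pi * k.2.val / L)
  rw [gridGap]; linarith

theorem gridGap_le {L : ℕ} (k : Vertex L) :
    gridGap k ≤ Real.pi ^ 2 / (L : ℝ) ^ 2 * ((k.1.val : ℝ) ^ 2 + (k.2.val : ℝ) ^ 2) := by
  have h1 := sin_sq_le k.1
  have h2 := sin_sq_le k.2
  rw [gridGap]
  calc _ ≤ _ := add_le_add h1 h2
    _ = _ := by ring

theorem le_gridGap (k : Vertex L) :
    4 / (L : ℝ) ^ 2 * ((cycleNorm k.1 : ℝ) ^ 2 + (cycleNorm k.2 : ℝ) ^ 2) ≤ gridGap k := by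
  have h1 := le_sin_sq k.1
  have h2 := le_sin_sq k.2
  rw [gridGap]
  calc _ = _ := by ring
    _ ≤ _ := add_le_add h1 h2

theorem cycleNorm_sq_add_sq_pos {k : Vertex L} (hk : k ≠ 0) :
    (0 : ℝ) < (cycleNorm k.1 : ℝ) ^ 2 + (cycleNorm k.2 : ℝ) ^ 2 := by
  by_cases h1 : k.1 = 0
  · have h2 : k.2 ≠ 0 := fun h2 => hk (Prod.ext h1 h2)
    have : (0 : ℝ) < cycleNorm k.2 := Nat.cast_pos.2 (cycleNorm_pos h2)
    positivity
  · have : (0 : ℝ) < cycleNorm k.1 := Nat.cast_pos.2 (cycleNorm_pos h1)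
    positivity

theorem gridGap_pos {k : Vertex L} (hk : k ≠ 0) : 0 < gridGap k := by
  have hL : (0 : ℝ) < L := Nat.cast_pos.2 (NeZero.pos L)
  have := cycleNorm_sq_add_sq_pos hk
  exact lt_of_lt_of_le (by positivity) (le_gridGap k)

/-- The eigenvalue of the `t`-step random walk at the `k`-th character. -/
noncomputable def gridEigenvalue (L t : ℕ) (k : Vertex L) : ℝ := (1 - gridGap k) ^ t

theorem isSpectral_gridModel (ht : Odd t) (m : Vertex L) :
    (gridModel t m).IsSpectral (charBasis L) 0 (gridEigenvalue L t) ((L : ℝ)⁻¹) where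
  A_b k := by
    rw [charBasis_apply, gridModel_A_charVec, gridEigenvalue]
  ℓ_zero := by simp [gridEigenvalue, gridGap]
  ℓ_lt k hk := by
    have := (one_sub_pow_bounds (gridGap_pos hk) (gridGap_le_two k) ht).1
    rw [gridEigenvalue]; linarith
  κ_pos := inv_pos.2 (Nat.cast_pos.2 (NeZero.pos L))
  norm_inner k := by
    change ‖inner ℂ (charBasis L k) (EuclideanSpace.single m 1)‖ = _
    rw [norm_inner_symm, EuclideanSpace.inner_single_left, map_one, one_mul, charBasis_apply,
      charVec_apply, norm_mul, norm_gridChar]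
    simp

open SearchModel

/-! ### Resolvent sums of the grid and asymptotics -/

section Resolvent

variable {L t : ℕ} [NeZero L]

theorem card_ne_zero_le :
    ((Finset.univ.filter (fun k : Vertex L => k ≠ 0)).card : ℝ) ≤ (L : ℝ) ^ 2 := by
  have h : (Finset.univ.filter (fun k : Vertex L => k ≠ 0)).card ≤ L ^ 2 := by
    refine (Finset.card_filter_le _ _).trans ?_
    rw [Finset.card_univ, Fintype.card_prod, ZMod.card, pow_two]
  exact_mod_cast h

theorem one_div_gridGap_le {k : Vertex L} (hk : k ≠ 0) : 1 / gridGap k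
    ≤ (L : ℝ) ^ 2 / 4 * (1 / ((cycleNorm k.1 : ℝ) ^ 2 + (cycleNorm k.2 : ℝ) ^ 2)) := by
  have hL : (0 : ℝ) < L := Nat.cast_pos.2 (NeZero.pos L)
  have h := cycleNorm_sq_add_sq_pos hk
  calc _ ≤ 1 / (4 / (L : ℝ) ^ 2 * ((cycleNorm k.1 : ℝ) ^ 2 + (cycleNorm k.2 : ℝ) ^ 2)) :=
        one_div_le_one_div_of_le (by positivity) (le_gridGap k)
    _ = _ := by field_simp

theorem one_div_one_sub_gridEigenvalue_le (ht : Odd t) {k : Vertex L} (hk : k ≠ 0) :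
    0 < 1 - gridEigenvalue L t k ∧ 1 / (1 - gridEigenvalue L t k) ≤ 1 + (L : ℝ) ^ 2 / (4 * t)
      * (1 / ((cycleNorm k.1 : ℝ) ^ 2 + (cycleNorm k.2 : ℝ) ^ 2)) := by
  obtain ⟨h1, -, h2⟩ := one_sub_pow_bounds (gridGap_pos hk) (gridGap_le_two k) ht
  have ht0 : (0 : ℝ) < t := Nat.cast_pos.2 ht.pos
  refine ⟨h1, h2.trans ?_⟩
  have h3 := one_div_gridGap_le hk
  have h4 : (1 : ℝ) / (t * gridGap k) = 1 / t * (1 / gridGap k) := by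
    rw [one_div_mul_one_div]
  rw [h4]
  calc _ ≤ 1 + 1 / (t : ℝ)
        * ((L : ℝ) ^ 2 / 4 * (1 / ((cycleNorm k.1 : ℝ) ^ 2 + (cycleNorm k.2 : ℝ) ^ 2))) := by
        gcongr
    _ = _ := by ring

theorem resolventSum_le (ht : Odd t) : resolventSum (gridEigenvalue L t) 0
    ≤ (L : ℝ) ^ 2 + (L : ℝ) ^ 2 / t * (4 + Real.log ((L : ℝ) ^ 2)) := by
  calc _ ≤ ∑ k ∈ Finset.univ.filter (fun k : Vertex L => k ≠ 0), (1 + (L : ℝ) ^ 2 / (4 * t)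
        * (1 / ((cycleNorm k.1 : ℝ) ^ 2 + (cycleNorm k.2 : ℝ) ^ 2))) :=
        Finset.sum_le_sum fun k hk =>
          (one_div_one_sub_gridEigenvalue_le ht (Finset.mem_filter.1 hk).2).2
    _ ≤ (L : ℝ) ^ 2 + (L : ℝ) ^ 2 / (4 * t) * (16 + 8 * Real.log L) := by
        rw [Finset.sum_add_distrib, ← Finset.mul_sum, Finset.sum_const, nsmul_eq_mul, mul_one]
        exact add_le_add card_ne_zero_le
          (mul_le_mul_of_nonneg_left sum_inv_cycleNorm_sq_le (by positivity))
    _ = _ := by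
        rw [Real.log_pow]
        push_cast
        ring

theorem le_resolventSum (ht : Odd t) : (L : ℝ) ^ 2 * Real.log ((L : ℝ) ^ 2) / t / 40
    ≤ resolventSum (gridEigenvalue L t) 0 := by
  have hL : (0 : ℝ) < L := Nat.cast_pos.2 (NeZero.pos L)
  have hL1 : (1 : ℝ) ≤ L := by exact_mod_cast NeZero.one_le
  have ht0 : (0 : ℝ) < t := Nat.cast_pos.2 ht.pos
  have hpi : Real.pi ^ 2 ≤ 10 := by nlinarith [Real.pi_lt_d2, Real.pi_pos]
  have hlog : 0 ≤ Real.log L := Real.log_nonneg hL1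
  calc _ = (L : ℝ) ^ 2 / (10 * t) * (Real.log L / 2) := by
        rw [Real.log_pow]; push_cast; ring
    _ ≤ (L : ℝ) ^ 2 / (Real.pi ^ 2 * t) * (Real.log L / 2) := by gcongr
    _ ≤ (L : ℝ) ^ 2 / (Real.pi ^ 2 * t) * ∑ k ∈ Finset.univ.filter (fun k : Vertex L => k ≠ 0),
          (1 : ℝ) / ((k.1.val : ℝ) ^ 2 + (k.2.val : ℝ) ^ 2) :=
        mul_le_mul_of_nonneg_left log_le_sum_inv_val_sq (by positivity)
    _ ≤ _ := by
        rw [Finset.mul_sum]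
        refine Finset.sum_le_sum fun k hk => ?_
        have hk0 := (Finset.mem_filter.1 hk).2
        obtain ⟨h1, h2, -⟩ := one_sub_pow_bounds (gridGap_pos hk0) (gridGap_le_two k) ht
        calc _ = 1 / (t * (Real.pi ^ 2 / (L : ℝ) ^ 2
              * ((k.1.val : ℝ) ^ 2 + (k.2.val : ℝ) ^ 2))) := by
              field_simp
          _ ≤ _ := by
              refine one_div_le_one_div_of_le h1 (h2.trans ?_)
              exact mul_le_mul_of_nonneg_left (gridGap_le k) ht0.le

theorem resolventSqSum_le (ht : Odd t) : resolventSqSum (gridEigenvalue L t) 0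
    ≤ 2 * (L : ℝ) ^ 2 + 3 * ((L : ℝ) ^ 2 / t) ^ 2 := by
  calc _ ≤ ∑ k ∈ Finset.univ.filter (fun k : Vertex L => k ≠ 0),
        (2 + 2 * ((L : ℝ) ^ 2 / (4 * t)) ^ 2
          * (1 / ((cycleNorm k.1 : ℝ) ^ 2 + (cycleNorm k.2 : ℝ) ^ 2)) ^ 2) := by
        refine Finset.sum_le_sum fun k hk => ?_
        obtain ⟨h1, h2⟩ := one_div_one_sub_gridEigenvalue_le ht (Finset.mem_filter.1 hk).2
        have h3 := pow_le_pow_left₀ (one_div_pos.2 h1).le h2 2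
        refine h3.trans ?_
        have h4 := add_sq_le (a := (1 : ℝ)) (b := (L : ℝ) ^ 2 / (4 * t)
          * (1 / ((cycleNorm k.1 : ℝ) ^ 2 + (cycleNorm k.2 : ℝ) ^ 2)))
        calc _ ≤ _ := h4
          _ = _ := by ring
    _ ≤ (L : ℝ) ^ 2 * 2 + 2 * ((L : ℝ) ^ 2 / (4 * t)) ^ 2 * 24 := by
        rw [Finset.sum_add_distrib, ← Finset.mul_sum, Finset.sum_const, nsmul_eq_mul]
        exact add_le_add (mul_le_mul_of_nonneg_right card_ne_zero_le zero_le_two)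
          (mul_le_mul_of_nonneg_left sum_inv_cycleNorm_sq_sq_le (by positivity))
    _ = _ := by ring

theorem successProb_eq (m : Vertex L) (n : ℕ) : successProb t m n
    = ‖inner ℂ ((gridModel t m).B (gridModel t m).δ)
        (((gridModel t m).U ^ n) ((gridModel t m).B (charBasis L 0)))‖ ^ 2 := by
  rw [successProb, searchOp_eq, startState_eq, psi_eq]
  rfl

theorem successProb_le_one (m : Vertex L) (n : ℕ) : successProb t m n ≤ 1 := by
  rw [successProb_eq]
  refine pow_le_one₀ (norm_nonneg _) ((norm_inner_le_norm _ _).trans ?_)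
  rw [norm_U_pow, norm_B, norm_B, (gridModel t m).norm_δ, (charBasis L).orthonormal.1, one_mul]

/-- The phase and the success probability of the search, in terms of the resolvent sums. After
`⌊π / (2 θ)⌋` iterations the accumulated phase is within `θ` of `π / 2`. -/
theorem search_bounds (ht : Odd t) (m : Vertex L) {R R₂ : ℝ}
    (hRdef : R = resolventSum (gridEigenvalue L t) 0)
    (hR2def : R₂ = resolventSqSum (gridEigenvalue L t) 0)
    (hR : 2 ≤ R) (hR2 : 8 * R₂ ≤ R ^ 2) (hR2' : 1024 * R₂ ≤ (L : ℝ) ^ 2 * R) :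
    IsLeast (eigenphases t m) (alpha t m) ∧
      1 / R ≤ alpha t m ^ 2 ∧ alpha t m ^ 2 ≤ 5 / R ∧
      (L : ℝ) ^ 2 / (256 * R) ≤ successProb t m (iterations t m) := by
  have hL : (0 : ℝ) < L := Nat.cast_pos.2 (NeZero.pos L)
  have hR0 : 0 < R := by linarith
  subst hRdef hR2def
  set R := resolventSum (gridEigenvalue L t) 0 with hRdef
  set R₂ := resolventSqSum (gridEigenvalue L t) 0 with hR2def
  obtain ⟨θ, hleast, hpi, hlow, hup, hamp⟩ :=
    (isSpectral_gridModel ht m).exists_least_eigenphase (by linarith) hR2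
  rw [← hRdef] at hlow hup
  rw [← searchOp_eq] at hleast
  have hα : alpha t m = θ := hleast.csInf_eq
  have hθ0 : 0 < θ := hleast.1.1
  refine ⟨by rw [hα]; exact hleast, ?_, ?_, ?_⟩
  · rw [hα]
    have h1 := Real.one_sub_sq_div_two_le_cos (x := θ)
    have h2 : 1 / (2 * R) = 1 / R / 2 := by rw [div_div, mul_comm]
    linarith
  · rw [hα]
    have h1 := Real.cos_le_one_sub_mul_cos_sq (x := θ) (by rw [abs_of_pos hθ0]; exact hpi.le)
    have h2 : 2 / Real.pi ^ 2 * θ ^ 2 ≤ 1 / R := by linarith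
    have hpi2 : Real.pi ^ 2 ≤ 10 := by nlinarith [Real.pi_lt_d2, Real.pi_pos]
    have h3 : 2 / 10 * θ ^ 2 ≤ 2 / Real.pi ^ 2 * θ ^ 2 := by gcongr
    have h4 : 5 / R = 5 * (1 / R) := by ring
    linarith
  · set n := iterations t m with hn
    have hcos : 1 / 2 ≤ Real.cos θ := by
      have : 1 / R ≤ 1 / 2 := one_div_le_one_div_of_le two_pos hR
      linarith
    have hsinθ : 0 < Real.sin θ := Real.sin_pos_of_pos_of_lt_pi hθ0 hpi
    have hn1 : (n : ℝ) * θ ≤ Real.pi / 2 := by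
      have h := Nat.floor_le (a := Real.pi / (2 * θ)) (by positivity)
      rw [hn, iterations, hα]
      calc _ ≤ Real.pi / (2 * θ) * θ := by gcongr
        _ = _ := by field_simp
    have hn2 : Real.pi / 2 - θ ≤ n * θ := by
      have h := (Nat.lt_floor_add_one (Real.pi / (2 * θ))).le
      rw [hn, iterations, hα]
      have h5 : Real.pi / 2 = Real.pi / (2 * θ) * θ := by field_simp
      have h6 := mul_le_mul_of_nonneg_right h hθ0.le
      rw [h5]; linarith
    have hsin : 1 / 2 ≤ Real.sin (n * θ) := by
      rw [← Real.sin_pi_div_two_sub] at hcos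
      refine hcos.trans (Real.sin_le_sin_of_le_of_le_pi_div_two ?_ hn1 hn2)
      have : θ ≤ Real.pi / 2 := by
        by_contra h
        rw [Real.sin_pi_div_two_sub] at hcos
        have := Real.cos_nonpos_of_pi_div_two_le_of_le (not_le.1 h).le (by linarith)
        linarith
      linarith [Real.pi_pos]
    have hamp' := hamp n (by linarith)
    set x := 1 - Real.cos θ with hx
    have hx0 : 0 < x := lt_of_lt_of_le (by positivity) hlow
    -- `x / sin θ = tan (θ / 2) ≥ √(x / 2)`
    have hquot : 1 / (2 * Real.sqrt R) ≤ x / Real.sin θ := by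
      refine (pow_le_pow_iff_left₀ (by positivity) (by positivity) two_ne_zero).1 ?_
      have h7 : Real.sin θ ^ 2 ≤ 2 * x := by
        rw [Real.sin_sq, hx]; nlinarith [Real.neg_one_le_cos θ, Real.cos_le_one θ]
      calc (1 / (2 * Real.sqrt R)) ^ 2 = 1 / (2 * R) / 2 := by
            rw [div_pow, mul_pow, Real.sq_sqrt hR0.le]; ring
        _ ≤ x / 2 := by gcongr
        _ = x ^ 2 / (2 * x) := by field_simp
        _ ≤ x ^ 2 / Real.sin θ ^ 2 := by gcongr
        _ = _ := by rw [div_pow]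
    have hmain : (L : ℝ) / (8 * Real.sqrt R)
        ≤ 1 / 2 * (x / (L : ℝ)⁻¹ * (Real.sin (n * θ) / Real.sin θ)) := by
      calc _ = 1 / 2 * (L * (1 / 2) * (1 / (2 * Real.sqrt R))) := by ring
        _ ≤ 1 / 2 * (L * Real.sin (n * θ) * (x / Real.sin θ)) := by gcongr
        _ = _ := by rw [div_inv_eq_mul]; ring
    -- the hypothesis `1024 R₂ ≤ N R` makes the error at most half of the main term
    have herr : 2 * (Real.sqrt R₂ / R) ≤ L / (16 * Real.sqrt R) := by
      have hs : 0 < Real.sqrt R := Real.sqrt_pos.2 hR0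
      have h8 : 32 * Real.sqrt R₂ ≤ L * Real.sqrt R := by
        have h9 : Real.sqrt (1024 * R₂) ≤ Real.sqrt ((L : ℝ) ^ 2 * R) := Real.sqrt_le_sqrt hR2'
        rw [Real.sqrt_mul (by norm_num), Real.sqrt_mul (by positivity), Real.sqrt_sq hL.le] at h9
        have h10 : Real.sqrt 1024 = 32 := by
          rw [show (1024 : ℝ) = 32 ^ 2 by norm_num, Real.sqrt_sq (by norm_num)]
        rwa [h10] at h9
      have h11 := Real.mul_self_sqrt hR0.le
      rw [← mul_div_assoc, div_le_div_iff₀ hR0 (by positivity)]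
      calc 2 * Real.sqrt R₂ * (16 * Real.sqrt R) = 32 * Real.sqrt R₂ * Real.sqrt R := by ring
        _ ≤ L * Real.sqrt R * Real.sqrt R := by gcongr
        _ = L * R := by rw [mul_assoc, h11]
    rw [successProb_eq]
    have hfin : (L : ℝ) / (16 * Real.sqrt R) ≤ ‖inner ℂ ((gridModel t m).B (gridModel t m).δ)
        (((gridModel t m).U ^ n) ((gridModel t m).B (charBasis L 0)))‖ := by
      have h12 : (L : ℝ) / (8 * Real.sqrt R) = 2 * (L / (16 * Real.sqrt R)) := by ring
      linarith
    calc _ = ((L : ℝ) / (16 * Real.sqrt R)) ^ 2 := by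
          rw [div_pow, mul_pow, Real.sq_sqrt hR0.le]; norm_num
      _ ≤ _ := by gcongr

/-- The resolvent sums are `R = Θ(T)` and `R₂ = o(T²)`, `R₂ = o(N T)` with `T = N log N / t`. The
thresholds on `N` are those for which `8 R₂ ≤ R²` and `1024 R₂ ≤ N R` follow from the explicit
bounds on `R` and `R₂`. -/
theorem search_asymptotics {C : ℝ} (hC : 0 < C) (ht : Odd t) (m : Vertex L)
    (hlog : 245760 ≤ Real.log ((L : ℝ) ^ 2))
    (hN : C * (163840 + 51200 * C) ≤ (L : ℝ) ^ 2)
    (htC : (t : ℝ) ≤ C * Real.log ((L : ℝ) ^ 2)) :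
    IsLeast (eigenphases t m) (alpha t m) ∧
      (Real.sqrt (C + 2))⁻¹ * Real.sqrt (t / ((L : ℝ) ^ 2 * Real.log ((L : ℝ) ^ 2)))
        ≤ alpha t m ∧
      alpha t m ≤ 15 * Real.sqrt (t / ((L : ℝ) ^ 2 * Real.log ((L : ℝ) ^ 2))) ∧
      (256 * (C + 2))⁻¹ * (t / Real.log ((L : ℝ) ^ 2))
        ≤ successProb t m (iterations t m) := by
  have hL : (0 : ℝ) < L := Nat.cast_pos.2 (NeZero.pos L)
  have ht1 : (1 : ℝ) ≤ t := by exact_mod_cast ht.pos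
  have hup := resolventSum_le (L := L) ht
  have hlow := le_resolventSum (L := L) ht
  have hsq := resolventSqSum_le (L := L) ht
  set N := (L : ℝ) ^ 2 with hNdef
  set ln := Real.log N with hln
  have hN0 : 0 < N := by positivity
  have hln0 : 0 < ln := by linarith
  set T := N * ln / t with hT
  set R := resolventSum (gridEigenvalue L t) 0 with hR
  set R₂ := resolventSqSum (gridEigenvalue L t) 0 with hR2
  have hTN : N ≤ C * T := by
    rw [hT, ← mul_div_assoc, le_div_iff₀ (by positivity)]
    calc N * t ≤ N * (C * ln) := by gcongr
      _ = _ := by ring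
  have hT0 : 0 < T := by positivity
  have hTbig : 163840 + 51200 * C ≤ T := le_of_mul_le_mul_left (hN.trans hTN) hC
  have hRup : R ≤ (C + 2) * T := by
    calc R ≤ N + N / t * (4 + ln) := hup
      _ ≤ C * T + N / t * (2 * ln) := by gcongr; linarith
      _ = _ := by rw [hT]; ring
  have hR4 : 4096 ≤ R := by linarith
  have hNt : (N / t) ^ 2 = T ^ 2 / ln ^ 2 := by
    rw [hT]; field_simp
  have hNt1 : (N / t) ^ 2 ≤ T ^ 2 / 245760 := by
    rw [hNt]
    gcongr
    nlinarith
  have hNt2 : (N / t) ^ 2 ≤ N * T / 245760 := by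
    calc (N / t) ^ 2 = N * T / (ln * t) := by rw [hT]; field_simp
      _ ≤ N * T / 245760 := by
        gcongr
        nlinarith
  have hc1 : 8 * R₂ ≤ R ^ 2 := by
    have h1 : T ^ 2 / 1600 ≤ R ^ 2 := by
      calc T ^ 2 / 1600 = (T / 40) ^ 2 := by ring
        _ ≤ _ := by gcongr
    have h2 : 16 * N ≤ T ^ 2 / 3200 := by nlinarith
    nlinarith
  have hc2 : 1024 * R₂ ≤ N * R := by
    have h1 : N * (T / 40) ≤ N * R := by gcongr
    have h2 : N * 163840 ≤ N * T := by gcongr; nlinarith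
    linarith
  obtain ⟨h1, h2, h3, h4⟩ := search_bounds ht m hR hR2 (by linarith) hc1 hc2
  have hα0 : 0 < alpha t m := h1.1.1
  have hs : t / (N * ln) = 1 / T := by rw [hT]; field_simp
  have hR0 : 0 < R := by linarith
  refine ⟨h1, ?_, ?_, ?_⟩
  · rw [hs, ← Real.sqrt_inv, ← Real.sqrt_mul (by positivity)]
    refine Real.sqrt_le_iff.2 ⟨hα0.le, le_trans ?_ h2⟩
    calc (C + 2)⁻¹ * (1 / T) = 1 / ((C + 2) * T) := by field_simp
      _ ≤ 1 / R := one_div_le_one_div_of_le hR0 hRup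
  · rw [hs]
    have h5 : alpha t m ^ 2 ≤ 15 ^ 2 * (1 / T) := by
      refine h3.trans ?_
      rw [mul_one_div, div_le_div_iff₀ hR0 hT0]
      linarith
    have h6 := Real.sqrt_le_sqrt h5
    rwa [Real.sqrt_sq hα0.le, Real.sqrt_mul (by norm_num), Real.sqrt_sq (by norm_num)] at h6
  · refine le_trans ?_ h4
    have h7 : (t : ℝ) / ln = N / T := by rw [hT]; field_simp
    rw [h7]
    calc (256 * (C + 2))⁻¹ * (N / T) = N / (256 * ((C + 2) * T)) := by field_simp
      _ ≤ N / (256 * R) := by gcongr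

end Resolvent

theorem eventually_large (a b : ℝ) : ∃ L₀ : ℕ, ∀ L : ℕ, L₀ ≤ L →
    a ≤ Real.log ((L : ℝ) ^ 2) ∧ b ≤ (L : ℝ) ^ 2 := by
  have h1 : Filter.Tendsto (fun L : ℕ => (L : ℝ) ^ 2) Filter.atTop Filter.atTop :=
    (Filter.tendsto_pow_atTop two_ne_zero).comp tendsto_natCast_atTop_atTop
  exact Filter.eventually_atTop.1
    (((Real.tendsto_log_atTop.comp h1).eventually_ge_atTop a).and (h1.eventually_ge_atTop b))

/-- If the phase is of order `1 / n` then the number of iterations is of order `n`. -/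
theorem floor_bounds {α a₁ a₂ n : ℝ} (ha₁ : 0 < a₁) (ha₂ : 0 < a₂) (hn : a₂ ≤ n)
    (h1 : a₁ / n ≤ α) (h2 : α ≤ a₂ / n) :
    (2 * a₂)⁻¹ * n ≤ (⌊Real.pi / (2 * α)⌋₊ : ℝ) ∧
      (⌊Real.pi / (2 * α)⌋₊ : ℝ) ≤ 2 / a₁ * n := by
  have hn0 : 0 < n := ha₂.trans_le hn
  have hα : 0 < α := lt_of_lt_of_le (by positivity) h1
  have hα1 : α ≤ 1 := h2.trans ((div_le_one hn0).2 hn)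
  constructor
  · have h3 := (Nat.lt_floor_add_one (Real.pi / (2 * α))).le
    have h4 : 3 / 2 * (1 / α) ≤ Real.pi / (2 * α) := by
      calc 3 / 2 * (1 / α) = 3 / (2 * α) := by field_simp
        _ ≤ _ := by gcongr; exact Real.pi_gt_three.le
    have h5 : 1 ≤ 1 / α := by rwa [le_div_iff₀ hα, one_mul]
    have h6 : n / a₂ ≤ 1 / α := by
      rw [le_div_iff₀ hn0] at h2
      rw [div_le_div_iff₀ ha₂ hα]; linarith
    have h7 : (2 * a₂)⁻¹ * n = 1 / 2 * (n / a₂) := by field_simp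
    rw [h7]; linarith
  · refine (Nat.floor_le (by positivity)).trans ?_
    rw [div_le_iff₀ hn0] at h1
    rw [div_mul_eq_mul_div, div_le_div_iff₀ (by positivity) ha₁]
    nlinarith [Real.pi_lt_four, Real.pi_pos]

end GridSearch

theorem mainTheorem1 :
    -- the algorithm, written as a sequence of oracle queries, implements `U_t ^ Q`
    (∀ (L : ℕ) [NeZero L] (t : ℕ) (m : GridSearch.Vertex L),
      GridSearch.runGates m (GridSearch.searchGates t m)
          = GridSearch.searchOp t m ^ GridSearch.iterations t m ∧
        GridSearch.targetQueries t m = GridSearch.iterations t m ∧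
        GridSearch.graphQueries t m = t * GridSearch.iterations t m) ∧
    -- `t = O(log N)`, where `N = L ^ 2`
    (∀ C : ℝ, 0 < C → ∃ a₁ a₂ p : ℝ, 0 < a₁ ∧ 0 < a₂ ∧ 0 < p ∧ ∃ L₀ : ℕ,
      ∀ (L : ℕ) [NeZero L] (t : ℕ) (m : GridSearch.Vertex L), L₀ ≤ L → Odd t →
        (t : ℝ) ≤ C * Real.log ((L : ℝ) ^ 2) →
          IsLeast (GridSearch.eigenphases t m) (GridSearch.alpha t m) ∧
          a₁ * Real.sqrt (t / ((L : ℝ) ^ 2 * Real.log ((L : ℝ) ^ 2))) ≤ GridSearch.alpha t m ∧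
          GridSearch.alpha t m ≤ a₂ * Real.sqrt (t / ((L : ℝ) ^ 2 * Real.log ((L : ℝ) ^ 2))) ∧
          p * (t / Real.log ((L : ℝ) ^ 2))
            ≤ GridSearch.successProb t m (GridSearch.iterations t m)) ∧
    -- `t = Θ(log N)`
    (∀ c C : ℝ, 0 < c → 0 < C → ∃ p b₁ b₂ e₁ e₂ : ℝ,
      0 < p ∧ 0 < b₁ ∧ 0 < b₂ ∧ 0 < e₁ ∧ 0 < e₂ ∧ ∃ L₀ : ℕ,
      ∀ (L : ℕ) [NeZero L] (t : ℕ) (m : GridSearch.Vertex L), L₀ ≤ L → Odd t →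
        c * Real.log ((L : ℝ) ^ 2) ≤ t → (t : ℝ) ≤ C * Real.log ((L : ℝ) ^ 2) →
          p ≤ GridSearch.successProb t m (GridSearch.iterations t m) ∧
          GridSearch.successProb t m (GridSearch.iterations t m) ≤ 1 ∧
          b₁ * Real.sqrt ((L : ℝ) ^ 2) ≤ GridSearch.targetQueries t m ∧
          (GridSearch.targetQueries t m : ℝ) ≤ b₂ * Real.sqrt ((L : ℝ) ^ 2) ∧
          e₁ * (Real.sqrt ((L : ℝ) ^ 2) * Real.log ((L : ℝ) ^ 2)) ≤ GridSearch.graphQueries t m ∧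
          (GridSearch.graphQueries t m : ℝ)
            ≤ e₂ * (Real.sqrt ((L : ℝ) ^ 2) * Real.log ((L : ℝ) ^ 2))) := by
  refine ⟨fun L _ t m => ⟨GridSearch.runGates_searchGates t m, GridSearch.targetQueries_eq t m,
    GridSearch.graphQueries_eq t m⟩, fun C hC => ?_, fun c C hc hC => ?_⟩
  · obtain ⟨L₀, hL₀⟩ := GridSearch.eventually_large 245760 (C * (163840 + 51200 * C))
    refine ⟨(Real.sqrt (C + 2))⁻¹, 15, (256 * (C + 2))⁻¹, by positivity, by norm_num,
      by positivity, L₀, fun L _ t m hL ht htC => ?_⟩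
    exact GridSearch.search_asymptotics hC ht m (hL₀ L hL).1 (hL₀ L hL).2 htC
  · have hsC : 0 < Real.sqrt C := Real.sqrt_pos.2 hC
    have hsc : 0 < Real.sqrt c := Real.sqrt_pos.2 hc
    have hs2 : 0 < Real.sqrt (C + 2) := Real.sqrt_pos.2 (by linarith)
    set a₁ : ℝ := (Real.sqrt (C + 2))⁻¹ * Real.sqrt c with ha₁
    set a₂ : ℝ := 15 * Real.sqrt C with ha₂
    have ha₁0 : 0 < a₁ := by positivity
    have ha₂0 : 0 < a₂ := by positivity
    obtain ⟨L₀, hL₀⟩ := GridSearch.eventually_large 245760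
      (max (C * (163840 + 51200 * C)) (a₂ ^ 2))
    refine ⟨(256 * (C + 2))⁻¹ * c, (2 * a₂)⁻¹, 2 / a₁, c * (2 * a₂)⁻¹, C * (2 / a₁),
      by positivity, by positivity, by positivity, by positivity, by positivity, L₀,
      fun L _ t m hL ht htc htC => ?_⟩
    obtain ⟨hlog, hN⟩ := hL₀ L hL
    obtain ⟨-, h1, h2, h3⟩ := GridSearch.search_asymptotics hC ht m hlog
      ((le_max_left _ _).trans hN) htC
    have hN2 := (le_max_right _ _).trans hN
    rw [GridSearch.targetQueries_eq, GridSearch.graphQueries_eq]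
    set N := (L : ℝ) ^ 2 with hNdef
    set ln := Real.log N with hln
    have hln0 : 0 < ln := by linarith
    have hN0 : 0 < N := lt_of_lt_of_le (by positivity) hN2
    have hq1 : c ≤ t / ln := by rwa [le_div_iff₀ hln0]
    have hq2 : t / ln ≤ C := by rwa [div_le_iff₀ hln0]
    have hs : Real.sqrt (t / (N * ln)) = Real.sqrt (t / ln) / Real.sqrt N := by
      rw [← Real.sqrt_div (hc.le.trans hq1), div_div, mul_comm N]
    rw [hs] at h1 h2
    have hsN : 0 < Real.sqrt N := Real.sqrt_pos.2 hN0
    have hα1 : a₁ / Real.sqrt N ≤ GridSearch.alpha t m := by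
      refine le_trans ?_ h1
      rw [ha₁, mul_div_assoc]
      gcongr
    have hα2 : GridSearch.alpha t m ≤ a₂ / Real.sqrt N := by
      refine h2.trans ?_
      rw [ha₂, mul_div_assoc]
      gcongr
    obtain ⟨hQ1, hQ2⟩ := GridSearch.floor_bounds ha₁0 ha₂0 (Real.le_sqrt_of_sq_le hN2) hα1 hα2
    rw [← GridSearch.iterations] at hQ1 hQ2
    refine ⟨le_trans ?_ h3, GridSearch.successProb_le_one m _, hQ1, hQ2, ?_, ?_⟩
    · gcongr
    · push_cast
      calc _ = c * ln * ((2 * a₂)⁻¹ * Real.sqrt N) := by ring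
        _ ≤ _ := by gcongr
    · push_cast
      calc _ ≤ C * ln * (2 / a₁ * Real.sqrt N) := by gcongr
        _ = _ := by ring
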